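/- Let $\Omega\subseteq\mathbb R^3$ be open. An incompressible deformation of $\Omega$ is a smooth injective map $\varphi:\Omega\to\mathbb R^3$ whose deformation gradient $\mathbf F=(\partial\varphi^a/\partial X^A)$ satisfies $\det\mathbf F=1$. On $\varphi(\Omega)$ put $\mathbf b=\mathbf F\mathbf F^{\mathsf T}$, $\mathbf c=\mathbf b^{-1}$, $I_1=\operatorname{tr}\mathbf b$, $I_2=\tfrac12(I_1^2-\operatorname{tr}\mathbf b^2)$; use Cartesian coordinates $x^a$, write $_{|a}$ or $_{,a}$ for $\partial/\partial x^a$, and sum over the repeated index $n$. An incompressible isotropic Cauchy elastic solid has Cauchy stress $\boldsymbol\sigma=-p\,\mathbf g+\beta\,\mathbf b+\gamma\,\mathbf c$, where $p$ is a pressure field and $\beta=\beta(I_1,I_2)$, $\gamma=\gamma(I_1,I_2)$ are arbitrary smooth functions; it is hyperelastic if $\beta=2\,\partial W/\partial I_1$ and $\gamma=-2\,\partial W/\partial I_2$ for a smooth $W(I_1,I_2)$. Equilibrium without body forces, $\operatorname{div}\boldsymbol\sigma=0$, means $\mathrm dp=\boldsymbol\xi$ with $\xi_a=(\beta b^n_a+\gamma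 c^n_a)_{|n}$. A deformation $\varphi$ is universal for a class of solids if for every solid of the class there is a smooth pressure field on $\varphi(\Omega)$ with which equilibrium holds, and locally universal if such pressure fields exist near each point of $\varphi(\Omega)$. (1) For every incompressible deformation $\varphi$ the following are equivalent: $\varphi$ is locally universal for Cauchy elasticity; $\mathrm d\boldsymbol\xi=0$ for all $\beta,\gamma$; $\varphi$ is locally universal for hyperelasticity; $\mathrm d\boldsymbol\xi=0$ for all $W$; the following twelve tensors (the Cauchy-elastic universality constraints) are symmetric in $(a,b)$ on $\varphi(\Omega)$: $$b^n_{a|nb},\quad I_{i,b}\,b^n_{a|n}+(b^n_aI_{i,n})_{|b}\ (i=1,2),\quad I_{i,n}I_{i,b}\,b^n_a\ (i=1,2),\quad (I_{1,n}I_{2,b}+I_{2,n}I_{1,b})\,b^n_a,$$ and the same six with $\mathbf c$ in place of $\mathbf b$; the following nine tensors (Ericksen's constraints) are symmetric in $(a,b)$ on $\varphi(\Omega)$: $$b^n_{a|bn},\quad c^n_{a|bn},\quad b^n_{a|n}I_{1,b}+(b^n_aI_{1,n})_{|b},\quad c^n_{a|n}I_{2,b}+(c^n_aI_{2,n})_{|b},$$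 $$(b^n_aI_{2,n})_{|b}+b^n_{a|n}I_{2,b}-\big[(c^n_aI_{1,n})_{|b}+c^n_{a|n}I_{1,b}\big],\quad b^n_aI_{1,n}I_{1,b},\quad c^n_aI_{2,n}I_{2,b},$$ $$b^n_a(I_{1,b}I_{2,n}+I_{1,n}I_{2,b})-c^n_aI_{1,n}I_{1,b},\quad b^n_aI_{2,b}I_{2,n}-c^n_a(I_{1,b}I_{2,n}+I_{1,n}I_{2,b}).$$ (2) The sets of locally universal deformations of incompressible isotropic Cauchy elasticity and of incompressible isotropic hyperelasticity are identical; if $\Omega$ is simply connected, so are the sets of universal deformations. (3) Let $\varphi$ be a locally universal deformation and $f=(f^1,\dots,f^k):\Omega\to\mathbb R^k$ smooth (for instance, some or all of the coordinates $X^A$ of a chart). Consider inhomogeneous solids with inhomogeneity $f$, i.e. $\beta=\beta(f(X),I_1,I_2)$ and $\gamma=\gamma(f(X),I_1,I_2)$, respectively $W=W(f(X),I_1,I_2)$, with arbitrary smooth dependence on the arguments shown. Regard $f^A$ as a function on $\varphi(\Omega)$ and write $f^A_{,n}$ for its derivatives (for $f^A=X^A$ this is $(F^{-1})^A{}_n$).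 Call $f$ a universal (locally universal) inhomogeneity for $\varphi$ if for all such solids a pressure field exists on $\varphi(\Omega)$ (near each point of $\varphi(\Omega)$). Then the following are equivalent: $f$ is a locally universal inhomogeneity for Cauchy elasticity; $\mathrm d\boldsymbol\xi=0$ for all such $\beta,\gamma$; $f$ is a locally universal inhomogeneity for hyperelasticity; $\mathrm d\boldsymbol\xi=0$ for all such $W$; the tensors $$f^A_{,n}b^n_{a|b}+f^A_{,b}b^n_{a|n}+f^A_{,nb}\,b^n_a,\quad (f^A_{,n}I_{i,b}+f^A_{,b}I_{i,n})\,b^n_a\ (i=1,2),\quad (f^A_{,n}f^B_{,b}+f^B_{,n}f^A_{,b})\,b^n_a,$$ and the same with $\mathbf c$ in place of $\mathbf b$, are symmetric in $(a,b)$ for all $A\le B$; the tensors $$f^A_{,n}b^n_{a|b}+f^A_{,b}b^n_{a|n}+f^A_{,nb}\,b^n_a,\quad f^A_{,n}c^n_{a|b}+f^A_{,b}c^n_{a|n}+f^A_{,nb}\,c^n_a,$$ $$b^n_a(f^A_{,n}I_{1,b}+f^A_{,b}I_{1,n}),\quad c^n_a(f^A_{,n}I_{2,b}+f^A_{,b}I_{2,n}),\quad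 b^n_a(f^A_{,n}I_{2,b}+f^A_{,b}I_{2,n})-c^n_a(f^A_{,n}I_{1,b}+f^A_{,b}I_{1,n}),$$ $$b^n_a(f^A_{,n}f^B_{,b}+f^B_{,n}f^A_{,b}),\quad c^n_a(f^A_{,n}f^B_{,b}+f^B_{,n}f^A_{,b})$$ are symmetric in $(a,b)$ for all $A\le B$. (4) For every locally universal $\varphi$ and every $k$, the sets of locally universal inhomogeneities $f:\Omega\to\mathbb R^k$ of Cauchy elasticity and of hyperelasticity coincide. If $\Omega$ is simply connected, then for every universal $\varphi$ the sets of universal inhomogeneities coincide. -/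

import Mathlib

open scoped ContDiff

noncomputable section

namespace IncompressibleElasticity

/-- Euclidean 3-space with its Cartesian coordinates; in these coordinates the metric is `δ` and
covariant derivatives are partial derivatives, so the position of an index is immaterial. -/
abbrev E3 : Type := EuclideanSpace ℝ (Fin 3)

/-- The partial derivative `∂h/∂xⁱ` at `x`. -/
def pd (i : Fin 3) (h : E3 → ℝ) (x : E3) : ℝ :=
  fderiv ℝ h x (EuclideanSpace.single i 1)

/-! ### Kinematics -/

/-- `φ` is an incompressible deformation of the body `Ω` (an open set): a smooth injective map with
`J = det F = 1`. -/
structure IsIncompressibleDeformation (Ω : Set E3) (φ : E3 → E3) : Prop where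
  smooth : ContDiffOn ℝ ∞ φ Ω
  injective : Set.InjOn φ Ω
  det_eq_one : ∀ X ∈ Ω, (Matrix.of fun a A : Fin 3 => pd A (fun Y => φ Y a) X).det = 1

/-- The material point `X = φ⁻¹(x)` occupying the place `x ∈ φ(Ω)`. -/
def materialPoint (Ω : Set E3) (φ : E3 → E3) (x : E3) : E3 :=
  Function.invFunOn φ Ω x

/-- The deformation gradient `Fᵃ_A = ∂φᵃ/∂Xᴬ` as a field on the current configuration `φ(Ω)`. -/
def defGrad (Ω : Set E3) (φ : E3 → E3) (x : E3) : Matrix (Fin 3) (Fin 3) ℝ :=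
  Matrix.of fun a A => pd A (fun Y => φ Y a) (materialPoint Ω φ x)

/-- `b = F Fᵀ`. -/
def bField (Ω : Set E3) (φ : E3 → E3) (x : E3) : Matrix (Fin 3) (Fin 3) ℝ :=
  defGrad Ω φ x * (defGrad Ω φ x).transpose

/-- `c = F⁻ᵀ F⁻¹`, the inverse of `b`. -/
def cField (Ω : Set E3) (φ : E3 → E3) (x : E3) : Matrix (Fin 3) (Fin 3) ℝ :=
  ((defGrad Ω φ x)⁻¹).transpose * (defGrad Ω φ x)⁻¹

/-- `I₁ = tr b`. -/
def I1 (Ω : Set E3) (φ : E3 → E3) (x : E3) : ℝ :=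
  (bField Ω φ x).trace

/-- `I₂ = ½ (I₁² - tr b²)`. -/
def I2 (Ω : Set E3) (φ : E3 → E3) (x : E3) : ℝ :=
  (I1 Ω φ x ^ 2 - (bField Ω φ x * bField Ω φ x).trace) / 2

/-! ### Materials -/

/-- The response functions `β(X, I₁, I₂)`, `γ(X, I₁, I₂)` of an incompressible isotropic body. -/
structure Material where
  β : E3 → ℝ → ℝ → ℝ
  γ : E3 → ℝ → ℝ → ℝ

/-- Homogeneous incompressible isotropic Cauchy elastic materials: `β(I₁, I₂)` and `γ(I₁, I₂)` are
arbitrary smooth functions. -/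
def cauchyMaterials : Set Material :=
  {m | ∃ β γ : ℝ → ℝ → ℝ,
    ContDiff ℝ ∞ (fun q : ℝ × ℝ => β q.1 q.2) ∧ ContDiff ℝ ∞ (fun q : ℝ × ℝ => γ q.1 q.2) ∧
    m = ⟨fun _ => β, fun _ => γ⟩}

/-- Homogeneous incompressible isotropic hyperelastic materials: there is an energy function
`W(I₁, I₂)` with `β = 2 ∂W/∂I₁` and `γ = -2 ∂W/∂I₂`. -/
def hyperelasticMaterials : Set Material :=
  {m | ∃ W : ℝ → ℝ → ℝ,
    ContDiff ℝ ∞ (fun q : ℝ × ℝ => W q.1 q.2) ∧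
    m = ⟨fun _ i j => 2 * deriv (fun t => W t j) i, fun _ i j => -2 * deriv (fun t => W i t) j⟩}

/-- Cauchy elastic materials with the inhomogeneity `f = (f¹, …, fᵏ)`: the response functions
depend on `X` through `f(X)`, and are arbitrary otherwise. For instance, the `fᴬ` are some or all
of the coordinates `Xᴬ` of a (curvilinear) chart of the body. -/
def inhomCauchyMaterials {k : ℕ} (f : E3 → Fin k → ℝ) : Set Material :=
  {m | ∃ β γ : (Fin k → ℝ) → ℝ → ℝ → ℝ,
    ContDiff ℝ ∞ (fun q : (Fin k → ℝ) × ℝ × ℝ => β q.1 q.2.1 q.2.2) ∧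
    ContDiff ℝ ∞ (fun q : (Fin k → ℝ) × ℝ × ℝ => γ q.1 q.2.1 q.2.2) ∧
    m = ⟨fun X => β (f X), fun X => γ (f X)⟩}

/-- Hyperelastic materials with the inhomogeneity `f`: the energy function is `W(f(X), I₁, I₂)`. -/
def inhomHyperelasticMaterials {k : ℕ} (f : E3 → Fin k → ℝ) : Set Material :=
  {m | ∃ W : (Fin k → ℝ) → ℝ → ℝ → ℝ,
    ContDiff ℝ ∞ (fun q : (Fin k → ℝ) × ℝ × ℝ => W q.1 q.2.1 q.2.2) ∧
    m = ⟨fun X i j => 2 * deriv (fun t => W (f X) t j) i,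
         fun X i j => -2 * deriv (fun t => W (f X) i t) j⟩}

/-! ### Equilibrium -/

/-- The constitutively determined part `β b + γ c` of the Cauchy stress. -/
def extraStress (Ω : Set E3) (φ : E3 → E3) (m : Material) (x : E3) : Matrix (Fin 3) (Fin 3) ℝ :=
  m.β (materialPoint Ω φ x) (I1 Ω φ x) (I2 Ω φ x) • bField Ω φ x +
    m.γ (materialPoint Ω φ x) (I1 Ω φ x) (I2 Ω φ x) • cField Ω φ x

/-- The Cauchy stress `σ = -p g + β b + γ c`. -/
def cauchyStress (Ω : Set E3) (φ : E3 → E3) (m : Material) (p : E3 → ℝ) (x : E3) :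
    Matrix (Fin 3) (Fin 3) ℝ :=
  -(p x • (1 : Matrix (Fin 3) (Fin 3) ℝ)) + extraStress Ω φ m x

/-- The divergence `T^{an}_{|n}` of a tensor field. -/
def divergence (T : E3 → Matrix (Fin 3) (Fin 3) ℝ) (x : E3) (a : Fin 3) : ℝ :=
  ∑ n, pd n (fun y => T y a n) x

/-- With the pressure field `p`, equilibrium without body forces holds on the part `V` of the
current configuration. -/
def EquilibriumOn (V : Set E3) (Ω : Set E3) (φ : E3 → E3) (m : Material) (p : E3 → ℝ) : Prop :=
  ContDiffOn ℝ ∞ p V ∧ ∀ x ∈ V, ∀ a, divergence (cauchyStress Ω φ m p) x a = 0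

/-- The deformation can be maintained in the material by boundary tractions alone. -/
def AdmitsEquilibrium (Ω : Set E3) (φ : E3 → E3) (m : Material) : Prop :=
  ∃ p, EquilibriumOn (φ '' Ω) Ω φ m p

/-- Every point of the current configuration has a neighbourhood in which the deformation can be
maintained without body forces. -/
def AdmitsLocalEquilibrium (Ω : Set E3) (φ : E3 → E3) (m : Material) : Prop :=
  ∀ x ∈ φ '' Ω, ∃ V, IsOpen V ∧ x ∈ V ∧ V ⊆ φ '' Ω ∧ ∃ p, EquilibriumOn V Ω φ m p

/-- The one-form `ξ_a = (β b + γ c)_{an|n}` that the pressure gradient `p_{,a}` has to equal is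
curl-free. -/
def CurlFreePressureGradient (Ω : Set E3) (φ : E3 → E3) (m : Material) : Prop :=
  ∀ x ∈ φ '' Ω, ∀ a b,
    pd b (fun y => divergence (extraStress Ω φ m) y a) x =
      pd a (fun y => divergence (extraStress Ω φ m) y b) x

/-! ### Universal deformations and universal inhomogeneities -/

/-- The incompressible deformations of `Ω` that can be maintained without body forces in every
material of the class `M`. -/
def universalDeformations (M : Set Material) (Ω : Set E3) : Set (E3 → E3) :=
  {φ | IsIncompressibleDeformation Ω φ ∧ ∀ m ∈ M, AdmitsEquilibrium Ω φ m}

/-- The variant with locally defined pressure fields. -/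
def locallyUniversalDeformations (M : Set Material) (Ω : Set E3) : Set (E3 → E3) :=
  {φ | IsIncompressibleDeformation Ω φ ∧ ∀ m ∈ M, AdmitsLocalEquilibrium Ω φ m}

/-- The inhomogeneities `f` such that `φ` can be maintained without body forces in every material
of the class `M f`. -/
def universalInhomogeneities {k : ℕ} (M : (E3 → Fin k → ℝ) → Set Material) (Ω : Set E3)
    (φ : E3 → E3) : Set (E3 → Fin k → ℝ) :=
  {f | ContDiffOn ℝ ∞ f Ω ∧ ∀ m ∈ M f, AdmitsEquilibrium Ω φ m}

/-- The variant with locally defined pressure fields. -/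
def locallyUniversalInhomogeneities {k : ℕ} (M : (E3 → Fin k → ℝ) → Set Material) (Ω : Set E3)
    (φ : E3 → E3) : Set (E3 → Fin k → ℝ) :=
  {f | ContDiffOn ℝ ∞ f Ω ∧ ∀ m ∈ M f, AdmitsLocalEquilibrium Ω φ m}

/-! ### The constraints -/

/-- The tensor field `T_{ab}` is symmetric at all points of `U`. -/
def SymmetricOn (U : Set E3) (T : E3 → Fin 3 → Fin 3 → ℝ) : Prop :=
  ∀ x ∈ U, ∀ a b, T x a b = T x b a

/-- `T^n_{a|n}`. -/
def div1 (T : E3 → Matrix (Fin 3) (Fin 3) ℝ) (a : Fin 3) (x : E3) : ℝ :=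
  ∑ n, pd n (fun y => T y n a) x

/-- `T^n_{a|nb}`. -/
def hessDiv (T : E3 → Matrix (Fin 3) (Fin 3) ℝ) (x : E3) (a b : Fin 3) : ℝ :=
  pd b (div1 T a) x

/-- `T_a^n_{|bn}`. -/
def hessDiv' (T : E3 → Matrix (Fin 3) (Fin 3) ℝ) (x : E3) (a b : Fin 3) : ℝ :=
  ∑ n, pd n (pd b (fun y => T y a n)) x

/-- `I_{,b} T^n_{a|n} + (T^n_a I_{,n})_{|b}`. -/
def firstCoeff (T : E3 → Matrix (Fin 3) (Fin 3) ℝ) (I : E3 → ℝ) (x : E3) (a b : Fin 3) : ℝ :=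
  pd b I x * div1 T a x + pd b (fun y => ∑ n, T y n a * pd n I y) x

/-- `I_{,n} I_{,b} T^n_a`. -/
def pureCoeff (T : E3 → Matrix (Fin 3) (Fin 3) ℝ) (I : E3 → ℝ) (x : E3) (a b : Fin 3) : ℝ :=
  ∑ n, pd n I x * pd b I x * T x n a

/-- `(I_{,n} J_{,b} + J_{,n} I_{,b}) T^n_a`. -/
def mixedCoeff (T : E3 → Matrix (Fin 3) (Fin 3) ℝ) (I J : E3 → ℝ) (x : E3) (a b : Fin 3) : ℝ :=
  ∑ n, (pd n I x * pd b J x + pd n J x * pd b I x) * T x n a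

/-- The twelve universality constraints of incompressible isotropic Cauchy elasticity. -/
structure CauchyConstraints (Ω : Set E3) (φ : E3 → E3) : Prop where
  A0 : SymmetricOn (φ '' Ω) (hessDiv (bField Ω φ))
  A1 : SymmetricOn (φ '' Ω) (firstCoeff (bField Ω φ) (I1 Ω φ))
  A2 : SymmetricOn (φ '' Ω) (firstCoeff (bField Ω φ) (I2 Ω φ))
  A11 : SymmetricOn (φ '' Ω) (pureCoeff (bField Ω φ) (I1 Ω φ))
  A22 : SymmetricOn (φ '' Ω) (pureCoeff (bField Ω φ) (I2 Ω φ))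
  A12 : SymmetricOn (φ '' Ω) (mixedCoeff (bField Ω φ) (I1 Ω φ) (I2 Ω φ))
  B0 : SymmetricOn (φ '' Ω) (hessDiv (cField Ω φ))
  B1 : SymmetricOn (φ '' Ω) (firstCoeff (cField Ω φ) (I1 Ω φ))
  B2 : SymmetricOn (φ '' Ω) (firstCoeff (cField Ω φ) (I2 Ω φ))
  B11 : SymmetricOn (φ '' Ω) (pureCoeff (cField Ω φ) (I1 Ω φ))
  B22 : SymmetricOn (φ '' Ω) (pureCoeff (cField Ω φ) (I2 Ω φ))
  B12 : SymmetricOn (φ '' Ω) (mixedCoeff (cField Ω φ) (I1 Ω φ) (I2 Ω φ))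

/-- Ericksen's nine universality constraints of incompressible isotropic hyperelasticity. -/
structure EricksenConstraints (Ω : Set E3) (φ : E3 → E3) : Prop where
  A1 : SymmetricOn (φ '' Ω) (hessDiv' (bField Ω φ))
  A2 : SymmetricOn (φ '' Ω) (hessDiv' (cField Ω φ))
  A11 : SymmetricOn (φ '' Ω) (firstCoeff (bField Ω φ) (I1 Ω φ))
  A22 : SymmetricOn (φ '' Ω) (firstCoeff (cField Ω φ) (I2 Ω φ))
  A12 : SymmetricOn (φ '' Ω) (fun x a b =>
    firstCoeff (bField Ω φ) (I2 Ω φ) x a b - firstCoeff (cField Ω φ) (I1 Ω φ) x a b)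
  A111 : SymmetricOn (φ '' Ω) (pureCoeff (bField Ω φ) (I1 Ω φ))
  A222 : SymmetricOn (φ '' Ω) (pureCoeff (cField Ω φ) (I2 Ω φ))
  A112 : SymmetricOn (φ '' Ω) (fun x a b =>
    mixedCoeff (bField Ω φ) (I1 Ω φ) (I2 Ω φ) x a b - pureCoeff (cField Ω φ) (I1 Ω φ) x a b)
  A122 : SymmetricOn (φ '' Ω) (fun x a b =>
    pureCoeff (bField Ω φ) (I2 Ω φ) x a b - mixedCoeff (cField Ω φ) (I1 Ω φ) (I2 Ω φ) x a b)

/-- The scalar field `h` on the body, transplanted to the current configuration. If `h` is the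
coordinate function `Xᴬ`, its partial derivatives are `∂Xᴬ/∂xⁿ = F⁻ᴬ_n`. -/
def spatial (Ω : Set E3) (φ : E3 → E3) (h : E3 → ℝ) (x : E3) : ℝ :=
  h (materialPoint Ω φ x)

/-- `F⁻ᴬ_n T^n_{a|b} + F⁻ᴬ_b T^n_{a|n} + (F⁻ᴮ_b F⁻ᴬ_{n,B} - γ^m_{nb} F⁻ᴬ_m) T^n_a`, where
`F⁻ᴬ_n = h_{,n}`; the factor in parentheses is `(F⁻ᴬ_n)_{|b}`. -/
def inhomCoeff (T : E3 → Matrix (Fin 3) (Fin 3) ℝ) (h : E3 → ℝ) (x : E3) (a b : Fin 3) : ℝ :=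
  (∑ n, pd n h x * pd b (fun y => T y n a) x) + pd b h x * div1 T a x +
    ∑ n, pd b (pd n h) x * T x n a

/-- The universal inhomogeneity constraints of incompressible isotropic Cauchy elasticity.
With `fᴬ = Xᴬ` one has `pd n (spatial Ω φ fᴬ) = F⁻ᴬ_n`. -/
structure CauchyInhomConstraints (Ω : Set E3) (φ : E3 → E3) {k : ℕ} (f : E3 → Fin k → ℝ) :
    Prop where
  C0 : ∀ A, SymmetricOn (φ '' Ω) (inhomCoeff (bField Ω φ) (spatial Ω φ fun X => f X A))
  C1 : ∀ A, SymmetricOn (φ '' Ω)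
    (mixedCoeff (bField Ω φ) (spatial Ω φ fun X => f X A) (I1 Ω φ))
  C2 : ∀ A, SymmetricOn (φ '' Ω)
    (mixedCoeff (bField Ω φ) (spatial Ω φ fun X => f X A) (I2 Ω φ))
  C0' : ∀ A B, A ≤ B → SymmetricOn (φ '' Ω)
    (mixedCoeff (bField Ω φ) (spatial Ω φ fun X => f X A) (spatial Ω φ fun X => f X B))
  D0 : ∀ A, SymmetricOn (φ '' Ω) (inhomCoeff (cField Ω φ) (spatial Ω φ fun X => f X A))
  D1 : ∀ A, SymmetricOn (φ '' Ω)
    (mixedCoeff (cField Ω φ) (spatial Ω φ fun X => f X A) (I1 Ω φ))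
  D2 : ∀ A, SymmetricOn (φ '' Ω)
    (mixedCoeff (cField Ω φ) (spatial Ω φ fun X => f X A) (I2 Ω φ))
  D0' : ∀ A B, A ≤ B → SymmetricOn (φ '' Ω)
    (mixedCoeff (cField Ω φ) (spatial Ω φ fun X => f X A) (spatial Ω φ fun X => f X B))

/-- The universal inhomogeneity constraints of incompressible isotropic hyperelasticity. -/
structure HyperelasticInhomConstraints (Ω : Set E3) (φ : E3 → E3) {k : ℕ}
    (f : E3 → Fin k → ℝ) : Prop where
  C1 : ∀ A, SymmetricOn (φ '' Ω) (inhomCoeff (bField Ω φ) (spatial Ω φ fun X => f X A))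
  C2 : ∀ A, SymmetricOn (φ '' Ω) (inhomCoeff (cField Ω φ) (spatial Ω φ fun X => f X A))
  C11 : ∀ A, SymmetricOn (φ '' Ω)
    (mixedCoeff (bField Ω φ) (spatial Ω φ fun X => f X A) (I1 Ω φ))
  C22 : ∀ A, SymmetricOn (φ '' Ω)
    (mixedCoeff (cField Ω φ) (spatial Ω φ fun X => f X A) (I2 Ω φ))
  C12 : ∀ A, SymmetricOn (φ '' Ω) (fun x a b =>
    mixedCoeff (bField Ω φ) (spatial Ω φ fun X => f X A) (I2 Ω φ) x a b -
      mixedCoeff (cField Ω φ) (spatial Ω φ fun X => f X A) (I1 Ω φ) x a b)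
  C1' : ∀ A B, A ≤ B → SymmetricOn (φ '' Ω)
    (mixedCoeff (bField Ω φ) (spatial Ω φ fun X => f X A) (spatial Ω φ fun X => f X B))
  C2' : ∀ A B, A ≤ B → SymmetricOn (φ '' Ω)
    (mixedCoeff (cField Ω φ) (spatial Ω φ fun X => f X A) (spatial Ω φ fun X => f X B))

end IncompressibleElasticity

end

open IncompressibleElasticity

/-!
A locally universal deformation is one for which the one-form `ξ` of prescribed pressure gradients
is closed for every material of the class. On a ball a closed one-form has a primitive, the
pressure. On a simply connected configuration the germs of primitives form a covering space with
discrete fibre `ℝ`, which has a section; hence there is a global pressure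
(`exists_primitive_of_locally`).

For a weight `g = β(f, I₁, I₂)` the chain rule (`inhomCoeff_comp`) writes the gradient of
`div (g T)` as a linear combination of the tensors in the constraints on `T = b` or `T = c`, the
coefficients being `g` and its first and second derivatives. So the Cauchy elastic constraints make
`ξ` closed for all Cauchy elastic materials, among them the hyperelastic ones. Conversely, energies
that are monomials in `I₁ - I₁(x)`, `I₂ - I₂(x)`, `f - f(x)` isolate the hyperelastic constraints at
the point `x`.

The cycle is closed by showing that the hyperelastic constraints imply the Cauchy elastic ones.
The pure quadratic constraints say that `∇I₁` is an eigenvector of `b` and `∇I₂` one of `c`. Since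
`c = b⁻¹`, each is an eigenvector of both tensors, and the quadratic constraints decouple pointwise.
Moreover `∇I₁` and `∇I₂` are parallel (`StrainFields.grad_parallel`): otherwise they would have a
common eigenvalue `l`, a double root of the characteristic polynomial `l³ - I₁ l² + I₂ l - 1`, and
differentiating this equation would give `∇I₂ = l ∇I₁`. Where `∇I₁ ≠ 0`, the first-order constraint
on `b` and `I₁` says that `div b - ∇l` is a multiple of `∇I₁`; as `∇I₂` is parallel to `∇I₁` with
the same eigenvalue, it gives the one on `b` and `I₂`. Where `∇I₁` vanishes identically, the
coupled constraint reduces to the latter (`StrainFields.firstCoeff_symmetricOn`). The coupled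
constraint for inhomogeneities decouples by the parallelism of `∇I₁` and `∇I₂` alone.
-/

namespace IncompressibleElasticity

/-! ### Partial derivatives -/

section PartialDerivatives

variable {U : Set E3} {g h : E3 → ℝ} {x : E3}

theorem pd_add (hg : DifferentiableAt ℝ g x) (hh : DifferentiableAt ℝ h x) (i : Fin 3) :
    pd i (fun y => g y + h y) x = pd i g x + pd i h x := by
  simp [pd, fderiv_fun_add hg hh]

theorem pd_sub (hg : DifferentiableAt ℝ g x) (hh : DifferentiableAt ℝ h x) (i : Fin 3) :
    pd i (fun y => g y - h y) x = pd i g x - pd i h x := by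
  simp [pd, fderiv_fun_sub hg hh]

theorem pd_mul (hg : DifferentiableAt ℝ g x) (hh : DifferentiableAt ℝ h x) (i : Fin 3) :
    pd i (fun y => g y * h y) x = g x * pd i h x + h x * pd i g x := by
  simp [pd, fderiv_fun_mul hg hh]

theorem pd_const (r : ℝ) (i : Fin 3) : pd i (fun _ => r) x = 0 := by
  simp [pd]

theorem pd_const_mul (r : ℝ) (i : Fin 3) : pd i (fun y => r * h y) x = r * pd i h x := by
  simp only [pd]
  rw [show (fun y => r * h y) = r • h from rfl, fderiv_const_smul_field]
  simp

theorem pd_sub_const (r : ℝ) (i : Fin 3) : pd i (fun y => h y - r) x = pd i h x := by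
  simp [pd, fderiv_sub_const]

theorem pd_sum {ι : Type*} {s : Finset ι} {F : ι → E3 → ℝ}
    (hF : ∀ n ∈ s, DifferentiableAt ℝ (F n) x) (i : Fin 3) :
    pd i (fun y => ∑ n ∈ s, F n y) x = ∑ n ∈ s, pd i (F n) x := by
  simp [pd, fderiv_fun_sum hF]

theorem pd_congr (hgh : g =ᶠ[nhds x] h) (i : Fin 3) : pd i g x = pd i h x := by
  simp [pd, hgh.fderiv_eq]

theorem pd_congr_of_eqOn (hU : IsOpen U) (hx : x ∈ U) (hgh : ∀ y ∈ U, g y = h y) (i : Fin 3) :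
    pd i g x = pd i h x :=
  pd_congr (Filter.eventually_of_mem (hU.mem_nhds hx) hgh) i

theorem contDiffOn_pd (hU : IsOpen U) (hh : ContDiffOn ℝ ∞ h U) (i : Fin 3) :
    ContDiffOn ℝ ∞ (pd i h) U :=
  (hh.fderiv_of_isOpen hU (by simp)).clm_apply contDiffOn_const

theorem differentiableAt_of_contDiffOn (hh : ContDiffOn ℝ ∞ h U) (hU : IsOpen U)
    (hx : x ∈ U) : DifferentiableAt ℝ h x :=
  (hh.contDiffAt (hU.mem_nhds hx)).differentiableAt (by simp)

theorem pd_comm (hU : IsOpen U) (hh : ContDiffOn ℝ ∞ h U) (hx : x ∈ U) (i j : Fin 3) :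
    pd i (pd j h) x = pd j (pd i h) x := by
  have hat := hh.contDiffAt (hU.mem_nhds hx)
  have key : ∀ i j, pd i (pd j h) x =
      fderiv ℝ (fderiv ℝ h) x (EuclideanSpace.single i 1) (EuclideanSpace.single j 1) := by
    intro i j
    have hd : DifferentiableAt ℝ (fderiv ℝ h) x :=
      (hat.fderiv_right (m := 1) (by norm_cast)).differentiableAt (by simp)
    change fderiv ℝ (fun y => fderiv ℝ h y (EuclideanSpace.single j 1)) x _ = _
    rw [fderiv_clm_apply hd (differentiableAt_const _)]
    simp
  rw [key, key]
  exact (hat.isSymmSndFDerivAt (by simp; norm_cast)).eq _ _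

/-- The partial derivative of a function of finitely many real variables. -/
noncomputable def coordDeriv {ι : Type*} [Fintype ι] [DecidableEq ι] (i : ι)
    (H : (ι → ℝ) → ℝ) (q : ι → ℝ) : ℝ :=
  fderiv ℝ H q (Pi.single i 1)

theorem contDiff_coordDeriv {ι : Type*} [Fintype ι] [DecidableEq ι] {H : (ι → ℝ) → ℝ}
    (hH : ContDiff ℝ ∞ H) (i : ι) : ContDiff ℝ ∞ (coordDeriv i H) :=
  (hH.fderiv_right (by simp)).clm_apply contDiff_const

theorem coordDeriv_comm {ι : Type*} [Fintype ι] [DecidableEq ι] {H : (ι → ℝ) → ℝ}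
    (hH : ContDiff ℝ ∞ H) (i j : ι) (q : ι → ℝ) :
    coordDeriv i (coordDeriv j H) q = coordDeriv j (coordDeriv i H) q := by
  have hat := hH.contDiffAt (x := q)
  have key : ∀ i j, coordDeriv i (coordDeriv j H) q =
      fderiv ℝ (fderiv ℝ H) q (Pi.single i 1) (Pi.single j 1) := by
    intro i j
    have hd : DifferentiableAt ℝ (fderiv ℝ H) q :=
      (hat.fderiv_right (m := 1) (by norm_cast)).differentiableAt (by simp)
    change fderiv ℝ (fun y => fderiv ℝ H y (Pi.single j 1)) q _ = _
    rw [fderiv_clm_apply hd (differentiableAt_const _)]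
    simp
  rw [key, key]
  exact (hat.isSymmSndFDerivAt (by simp; norm_cast)).eq _ _

theorem pd_comp {ι : Type*} [Fintype ι] [DecidableEq ι] {H : (ι → ℝ) → ℝ} {F : ι → E3 → ℝ}
    (hH : ContDiff ℝ ∞ H) (hF : ∀ i, DifferentiableAt ℝ (F i) x) (n : Fin 3) :
    pd n (fun y => H fun i => F i y) x =
      ∑ i, coordDeriv i H (fun i => F i x) * pd n (F i) x := by
  have h1 : HasFDerivAt (fun y => fun i => F i y)
      (ContinuousLinearMap.pi fun i => fderiv ℝ (F i) x) x :=
    hasFDerivAt_pi.2 fun i => (hF i).hasFDerivAt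
  have h2 : HasFDerivAt H (fderiv ℝ H fun i => F i x) (fun i => F i x) :=
    (hH.contDiffAt.differentiableAt (by simp)).hasFDerivAt
  have h3 := h2.comp x h1
  simp only [pd]
  rw [show (fun y => H fun i => F i y) = H ∘ (fun y => fun i => F i y) from rfl, h3.fderiv,
    ContinuousLinearMap.comp_apply, pi_eq_sum_univ' (ContinuousLinearMap.pi _ _), map_sum]
  refine Finset.sum_congr rfl fun i _ => ?_
  rw [map_smul, smul_eq_mul, mul_comm]
  simp only [coordDeriv, ContinuousLinearMap.coe_pi']

end PartialDerivatives

/-! ### The derivatives of the divergence of a weighted tensor field -/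

section WeightedDivergence

variable {U : Set E3} {T : E3 → Matrix (Fin 3) (Fin 3) ℝ} {g h : E3 → ℝ} {x : E3}

theorem mixedCoeff_comm (T : E3 → Matrix (Fin 3) (Fin 3) ℝ) (g h : E3 → ℝ) :
    mixedCoeff T g h = mixedCoeff T h g := by
  funext x a b
  exact Finset.sum_congr rfl fun n _ => by ring

theorem mixedCoeff_self (T : E3 → Matrix (Fin 3) (Fin 3) ℝ) (g : E3 → ℝ) (x : E3) (a b : Fin 3) :
    mixedCoeff T g g x a b = 2 * pureCoeff T g x a b := by
  simp only [mixedCoeff, pureCoeff, Finset.mul_sum]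
  exact Finset.sum_congr rfl fun n _ => by ring

/-- The gradient of the divergence of `g T` splits into the part `inhomCoeff T g`, which carries
the derivatives of `g`, and `g` times the gradient of the divergence of `T`. -/
theorem pd_divergence_smul (hU : IsOpen U) (hT : ∀ a n, ContDiffOn ℝ ∞ (fun y => T y a n) U)
    (hsymm : ∀ y ∈ U, ∀ a n, T y a n = T y n a) (hg : ContDiffOn ℝ ∞ g U) (hx : x ∈ U)
    (a b : Fin 3) :
    pd b (fun y => divergence (fun z => g z • T z) y a) x =
      inhomCoeff T g x a b + g x * hessDiv T x a b := by
  have hTd : ∀ y ∈ U, ∀ a n, DifferentiableAt ℝ (fun y => T y a n) y := fun y hy a n =>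
    differentiableAt_of_contDiffOn (hT a n) hU hy
  have hgd : ∀ y ∈ U, DifferentiableAt ℝ g y := fun y hy =>
    differentiableAt_of_contDiffOn hg hU hy
  have hgn : ∀ n, DifferentiableAt ℝ (pd n g) x := fun n =>
    differentiableAt_of_contDiffOn (contDiffOn_pd hU hg n) hU hx
  have hTn : ∀ n, DifferentiableAt ℝ (pd n fun y => T y n a) x := fun n =>
    differentiableAt_of_contDiffOn (contDiffOn_pd hU (hT n a) n) hU hx
  have e1 : ∀ y ∈ U, divergence (fun z => g z • T z) y a =
      ∑ n, (g y * pd n (fun y => T y n a) y + T y n a * pd n g y) := by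
    intro y hy
    refine Finset.sum_congr rfl fun n _ => ?_
    rw [← pd_mul (hgd y hy) (hTd y hy n a)]
    refine pd_congr_of_eqOn hU hy (fun z hz => ?_) n
    simp [hsymm z hz a n]
  rw [pd_congr_of_eqOn hU hx e1, pd_sum]
  · have e2 : ∀ n, pd b (fun y => g y * pd n (fun y => T y n a) y + T y n a * pd n g y) x =
        g x * pd b (pd n fun y => T y n a) x + pd n (fun y => T y n a) x * pd b g x +
          (T x n a * pd b (pd n g) x + pd n g x * pd b (fun y => T y n a) x) := by
      intro n
      rw [pd_add ((hgd x hx).fun_mul (hTn n)) ((hTd x hx n a).fun_mul (hgn n)),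
        pd_mul (hgd x hx) (hTn n), pd_mul (hTd x hx n a) (hgn n)]
    have e3 : pd b (div1 T a) x = ∑ n, pd b (pd n fun y => T y n a) x := pd_sum (fun n _ => hTn n) b
    simp only [e2, inhomCoeff, hessDiv, e3, div1]
    simp only [Fin.sum_univ_three]
    ring
  · exact fun n _ => ((hgd x hx).fun_mul (hTn n)).fun_add ((hTd x hx n a).fun_mul (hgn n))

/-- By the product rule, the coefficient of the first derivative in the homogeneous constraints
is the one in the inhomogeneous constraints. -/
theorem firstCoeff_eq_inhomCoeff (hU : IsOpen U)
    (hT : ∀ a n, ContDiffOn ℝ ∞ (fun y => T y a n) U) (hg : ContDiffOn ℝ ∞ g U) (hx : x ∈ U)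
    (a b : Fin 3) : firstCoeff T g x a b = inhomCoeff T g x a b := by
  have hTd : ∀ n, DifferentiableAt ℝ (fun y => T y n a) x := fun n =>
    differentiableAt_of_contDiffOn (hT n a) hU hx
  have hgn : ∀ n, DifferentiableAt ℝ (pd n g) x := fun n =>
    differentiableAt_of_contDiffOn (contDiffOn_pd hU hg n) hU hx
  simp only [firstCoeff, inhomCoeff]
  rw [pd_sum fun n _ => (hTd n).fun_mul (hgn n)]
  simp only [fun n => pd_mul (hTd n) (hgn n) b, Fin.sum_univ_three]
  ring

theorem inhomCoeff_sub_const (r : ℝ) (a b : Fin 3) :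
    inhomCoeff T (fun y => g y - r) x a b = inhomCoeff T g x a b := by
  have e : ∀ n, pd n (fun y => g y - r) = pd n g := fun n => funext fun y => pd_sub_const r n
  simp only [inhomCoeff, e]

theorem inhomCoeff_const (r : ℝ) (a b : Fin 3) :
    inhomCoeff T (fun _ => r) x a b = 0 := by
  have e : ∀ n, pd n (fun _ => r) = fun _ => 0 := fun n => funext fun y => pd_const r n
  simp [inhomCoeff, e, pd_const]

theorem inhomCoeff_const_mul (r : ℝ) (a b : Fin 3) :
    inhomCoeff T (fun y => r * g y) x a b = r * inhomCoeff T g x a b := by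
  have e : ∀ n, pd n (fun y => r * g y) = fun y => r * pd n g y := fun n =>
    funext fun y => pd_const_mul r n
  simp only [inhomCoeff, e, pd_const_mul, Fin.sum_univ_three]
  ring

theorem inhomCoeff_mul (hU : IsOpen U) (hg : ContDiffOn ℝ ∞ g U) (hh : ContDiffOn ℝ ∞ h U)
    (hx : x ∈ U) (a b : Fin 3) :
    inhomCoeff T (fun y => g y * h y) x a b =
      g x * inhomCoeff T h x a b + h x * inhomCoeff T g x a b + mixedCoeff T g h x a b := by
  have d : ∀ {f : E3 → ℝ}, ContDiffOn ℝ ∞ f U → ∀ y ∈ U, DifferentiableAt ℝ f y :=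
    fun hf y hy => differentiableAt_of_contDiffOn hf hU hy
  have dn : ∀ {f : E3 → ℝ}, ContDiffOn ℝ ∞ f U → ∀ n, DifferentiableAt ℝ (pd n f) x :=
    fun hf n => d (contDiffOn_pd hU hf n) x hx
  have e : ∀ n, ∀ y ∈ U, pd n (fun y => g y * h y) y = g y * pd n h y + h y * pd n g y :=
    fun n y hy => pd_mul (d hg y hy) (d hh y hy) n
  have e2 : ∀ n, pd b (pd n fun y => g y * h y) x =
      g x * pd b (pd n h) x + pd n h x * pd b g x +
        (h x * pd b (pd n g) x + pd n g x * pd b h x) := by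
    intro n
    rw [pd_congr_of_eqOn hU hx (e n),
      pd_add ((d hg x hx).fun_mul (dn hh n)) ((d hh x hx).fun_mul (dn hg n)),
      pd_mul (d hg x hx) (dn hh n), pd_mul (d hh x hx) (dn hg n)]
  simp only [inhomCoeff, mixedCoeff, e2, fun n => e n x hx, Fin.sum_univ_three]
  ring

/-- The second-order chain rule for `inhomCoeff`. -/
theorem inhomCoeff_comp {ι : Type*} [Fintype ι] [DecidableEq ι] {H : (ι → ℝ) → ℝ}
    {F : ι → E3 → ℝ} (hU : IsOpen U) (hH : ContDiff ℝ ∞ H) (hF : ∀ i, ContDiffOn ℝ ∞ (F i) U)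
    (hx : x ∈ U) (a b : Fin 3) :
    inhomCoeff T (fun y => H fun i => F i y) x a b =
      ∑ i, coordDeriv i H (fun i => F i x) * inhomCoeff T (F i) x a b +
        (∑ i, ∑ j, coordDeriv j (coordDeriv i H) (fun i => F i x) *
          mixedCoeff T (F i) (F j) x a b) / 2 := by
  have d : ∀ y ∈ U, ∀ i, DifferentiableAt ℝ (F i) y := fun y hy i =>
    differentiableAt_of_contDiffOn (hF i) hU hy
  have dn : ∀ n i, DifferentiableAt ℝ (pd n (F i)) x := fun n i =>
    differentiableAt_of_contDiffOn (contDiffOn_pd hU (hF i) n) hU hx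
  have dH : ∀ i, DifferentiableAt ℝ (fun y => coordDeriv i H fun i => F i y) x := by
    intro i
    have h1 : DifferentiableAt ℝ (fun y => fun i => F i y) x := differentiableAt_pi.2 (d x hx)
    exact ((contDiff_coordDeriv hH i).contDiffAt.differentiableAt (by simp)).comp x h1
  have e : ∀ n, ∀ y ∈ U, pd n (fun y => H fun i => F i y) y =
      ∑ i, coordDeriv i H (fun i => F i y) * pd n (F i) y :=
    fun n y hy => pd_comp hH (d y hy) n
  have e2 : ∀ n, pd b (pd n fun y => H fun i => F i y) x =
      ∑ i, (coordDeriv i H (fun i => F i x) * pd b (pd n (F i)) x +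
        pd n (F i) x * ∑ j, coordDeriv j (coordDeriv i H) (fun i => F i x) * pd b (F j) x) := by
    intro n
    rw [pd_congr_of_eqOn hU hx (e n), pd_sum fun i _ => (dH i).fun_mul (dn n i)]
    refine Finset.sum_congr rfl fun i _ => ?_
    rw [pd_mul (dH i) (dn n i), pd_comp (contDiff_coordDeriv hH i) (d x hx)]
  set q : ι → ℝ := fun i => F i x
  -- Symmetrizing over the order of differentiation turns the second-order part into `mixedCoeff`.
  have e3 : ∀ n, (∑ i, pd n (F i) x * ∑ j, coordDeriv j (coordDeriv i H) q * pd b (F j) x) =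
      (∑ i, ∑ j, coordDeriv j (coordDeriv i H) q *
        (pd n (F i) x * pd b (F j) x + pd n (F j) x * pd b (F i) x)) / 2 := by
    intro n
    have s1 : (∑ i, ∑ j, coordDeriv j (coordDeriv i H) q * (pd n (F j) x * pd b (F i) x)) =
        ∑ i, ∑ j, coordDeriv j (coordDeriv i H) q * (pd n (F i) x * pd b (F j) x) := by
      rw [Finset.sum_comm]
      refine Finset.sum_congr rfl fun i _ => Finset.sum_congr rfl fun j _ => ?_
      rw [coordDeriv_comm hH]
    have s2 : (∑ i, pd n (F i) x * ∑ j, coordDeriv j (coordDeriv i H) q * pd b (F j) x) =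
        ∑ i, ∑ j, coordDeriv j (coordDeriv i H) q * (pd n (F i) x * pd b (F j) x) := by
      refine Finset.sum_congr rfl fun i _ => ?_
      rw [Finset.mul_sum]
      exact Finset.sum_congr rfl fun j _ => by ring
    simp only [mul_add, Finset.sum_add_distrib]
    rw [s1, s2]
    ring
  have e4 : ∑ i, ∑ j, coordDeriv j (coordDeriv i H) q * mixedCoeff T (F i) (F j) x a b =
      ∑ n, (∑ i, ∑ j, coordDeriv j (coordDeriv i H) q *
        (pd n (F i) x * pd b (F j) x + pd n (F j) x * pd b (F i) x)) * T x n a := by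
    simp only [mixedCoeff, Fin.sum_univ_three, Finset.sum_mul, ← Finset.sum_add_distrib]
    exact Finset.sum_congr rfl fun i _ => Finset.sum_congr rfl fun j _ => by ring
  have e5 : ∑ i, coordDeriv i H q * inhomCoeff T (F i) x a b =
      ∑ n, (∑ i, coordDeriv i H q * pd n (F i) x) * pd b (fun y => T y n a) x +
        (∑ i, coordDeriv i H q * pd b (F i) x) * div1 T a x +
        ∑ n, (∑ i, coordDeriv i H q * pd b (pd n (F i)) x) * T x n a := by
    simp only [inhomCoeff, Fin.sum_univ_three, Finset.sum_mul, ← Finset.sum_add_distrib]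
    exact Finset.sum_congr rfl fun i _ => by ring
  rw [e4, e5]
  simp only [inhomCoeff, e2, fun n => e n x hx, Finset.sum_add_distrib, e3, Fin.sum_univ_three]
  ring

/-- In the second covariant derivative of a symmetric tensor field the order of differentiation
does not matter. -/
theorem hessDiv'_eq_hessDiv (hU : IsOpen U) (hT : ∀ a n, ContDiffOn ℝ ∞ (fun y => T y a n) U)
    (hsymm : ∀ y ∈ U, ∀ a n, T y a n = T y n a) (hx : x ∈ U) (a b : Fin 3) :
    hessDiv' T x a b = hessDiv T x a b := by
  have e : pd b (div1 T a) x = ∑ n, pd b (pd n fun y => T y n a) x :=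
    pd_sum (fun n _ =>
      differentiableAt_of_contDiffOn (contDiffOn_pd hU (hT n a) n) hU hx) b
  rw [hessDiv', hessDiv, e]
  refine Finset.sum_congr rfl fun n _ => ?_
  rw [pd_comm hU (hT a n) hx]
  refine pd_congr_of_eqOn hU hx (fun y hy => ?_) b
  exact pd_congr_of_eqOn hU hy (fun z hz => hsymm z hz a n) n

end WeightedDivergence

/-! ### Closed one-forms on simply connected open sets -/

section Primitives

/-- The real numbers with the discrete topology: the fibre of the covering space of germs of
primitives of a closed one-form. -/
@[ext]
structure DiscreteReal where
  /-- The underlying real number. -/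
  toReal : ℝ

instance : TopologicalSpace DiscreteReal := ⊥

instance : DiscreteTopology DiscreteReal := ⟨rfl⟩

variable {E : Type*} [NormedAddCommGroup E] [NormedSpace ℝ E] {U : Set E} {η : E → E →L[ℝ] ℝ}

/-- Two primitives of a one-form differ by a constant on the intersection of two balls. -/
theorem exists_sub_eq_const_of_hasFDerivAt {f g : E → ℝ} {x y : E} {r s : ℝ}
    (hf : ∀ z ∈ Metric.ball x r, HasFDerivAt f (η z) z)
    (hg : ∀ z ∈ Metric.ball y s, HasFDerivAt g (η z) z) :
    ∃ c, ∀ z ∈ Metric.ball x r ∩ Metric.ball y s, f z - g z = c := by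
  have hpre : IsPreconnected (Metric.ball x r ∩ Metric.ball y s) :=
    ((convex_ball x r).inter (convex_ball y s)).isPreconnected
  have hd : ∀ z ∈ Metric.ball x r ∩ Metric.ball y s,
      HasFDerivAt (fun z => f z - g z) (0 : E →L[ℝ] ℝ) z := by
    intro z hz
    simpa using (hf z hz.1).fun_sub (hg z hz.2)
  obtain ⟨c, hc⟩ := (Metric.isOpen_ball.inter Metric.isOpen_ball).exists_is_const_of_fderiv_eq_zero
    hpre (fun z hz => (hd z hz).differentiableAt.differentiableWithinAt)
    (fun z hz => (hd z hz).fderiv)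
  exact ⟨c, hc⟩

/-- A one-form on a simply connected open set that has a primitive near every point has a global
primitive. The germs of its primitives form a covering space of `U`, with the additive constant as
discrete fibre; over a simply connected base this covering has a continuous section. -/
theorem exists_primitive_of_locally (hU : IsOpen U) (hsc : IsSimplyConnected U)
    (hloc : ∀ x ∈ U, ∃ r > 0, Metric.ball x r ⊆ U ∧
      ∃ f : E → ℝ, ∀ y ∈ Metric.ball x r, HasFDerivAt f (η y) y) :
    ∃ f : E → ℝ, ∀ x ∈ U, HasFDerivAt f (η x) x := by
  classical
  have := hsc.simplyConnectedSpace
  have := hU.locallyPathConnectedSpace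
  obtain ⟨x₀, hx₀⟩ := hsc.nonempty
  choose! r hr _ f hf using hloc
  let Z : FiberBundleCore U U DiscreteReal :=
    { baseSet := fun i => {y | (y : E) ∈ Metric.ball (i : E) (r i)}
      isOpen_baseSet := fun i => Metric.isOpen_ball.preimage continuous_subtype_val
      indexAt := id
      mem_baseSet_at := fun x => Metric.mem_ball_self (hr x x.2)
      coordChange := fun i j x v => ⟨v.toReal + (f i x - f j x)⟩
      coordChange_self := fun i x _ v => by simp
      continuousOn_coordChange := fun i j => by
        obtain ⟨c, hc⟩ := exists_sub_eq_const_of_hasFDerivAt (hf i i.2) (hf j j.2)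
        refine ContinuousOn.congr (f := fun p : U × DiscreteReal => ⟨p.2.toReal + c⟩) ?_
          fun p hp => ?_
        · exact ((continuous_of_discreteTopology
            (f := fun v : DiscreteReal => (⟨v.toReal + c⟩ : DiscreteReal))).comp
            continuous_snd).continuousOn
        · simp only [hc p.1 hp.1]
      coordChange_comp := fun i j k x _ v => by
        ext
        change v.toReal + (f i x - f j x) + (f j x - f k x) = v.toReal + (f i x - f k x)
        ring }
  have hcov : IsCoveringMap Z.proj := FiberBundle.isCoveringMap (F := DiscreteReal) (E := Z.Fiber)
  obtain ⟨F, ⟨-, hF⟩, -⟩ := hcov.existsUnique_continuousMap_lifts (ContinuousMap.id U) ⟨x₀, hx₀⟩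
    (⟨⟨x₀, hx₀⟩, (⟨0⟩ : DiscreteReal)⟩ : Z.TotalSpace) rfl
  have hF1 : ∀ x : U, (F x).1 = x := fun x => congrFun hF x
  let s : U → ℝ := fun x => DiscreteReal.toReal (F x).2
  refine ⟨fun x => if hx : x ∈ U then s ⟨x, hx⟩ + f x x else 0, fun x hx => ?_⟩
  -- In the trivialization over the ball around `x` the section is locally constant.
  have hcont : ContinuousAt (fun y : U => (Z.localTriv ⟨x, hx⟩ (F y)).2) ⟨x, hx⟩ := by
    have h1 : ContinuousAt (Z.localTriv ⟨x, hx⟩) (F ⟨x, hx⟩) := by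
      refine (Z.localTriv ⟨x, hx⟩).continuousAt ?_
      rw [Z.mem_localTriv_source, hF1]
      exact Metric.mem_ball_self (hr x hx)
    exact continuous_snd.continuousAt.comp (h1.comp F.continuous.continuousAt)
  have htriv : ∀ y : U, (Z.localTriv ⟨x, hx⟩ (F y)).2.toReal = s y + (f y y - f x y) := by
    intro y
    change DiscreteReal.toReal (F y).2 + (f (F y).1 (F y).1 - f x (F y).1) = _
    rw [hF1 y]
  have hconst : ∀ᶠ y in nhds x, ∀ hy : y ∈ U,
      s ⟨y, hy⟩ + (f y y - f x y) = s ⟨x, hx⟩ + (f x x - f x x) := by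
    have h2 := hcont.preimage_mem_nhds (isOpen_discrete {(Z.localTriv ⟨x, hx⟩ (F ⟨x, hx⟩)).2}
      |>.mem_nhds rfl)
    rw [nhds_subtype_eq_comap, Filter.mem_comap] at h2
    obtain ⟨t, ht, hts⟩ := h2
    filter_upwards [ht] with y hyt hy
    have h3 : (Z.localTriv ⟨x, hx⟩ (F ⟨y, hy⟩)).2 = (Z.localTriv ⟨x, hx⟩ (F ⟨x, hx⟩)).2 :=
      hts (show ((⟨y, hy⟩ : U) : E) ∈ t from hyt)
    have h4 := htriv ⟨y, hy⟩
    have h5 := htriv ⟨x, hx⟩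
    rw [← h4, ← h5, h3]
  refine ((hf x hx x (Metric.mem_ball_self (hr x hx))).const_add (s ⟨x, hx⟩)).congr_of_eventuallyEq
    ?_
  filter_upwards [hconst, hU.mem_nhds hx] with y hy hyU
  have := hy hyU
  simp only [hyU, dif_pos]
  linarith

theorem exists_primitive_ball (hU : IsOpen U) (hη : DifferentiableOn ℝ η U)
    (hclosed : ∀ x ∈ U, ∀ v w, fderiv ℝ η x v w = fderiv ℝ η x w v) :
    ∀ x ∈ U, ∃ r > 0, Metric.ball x r ⊆ U ∧
      ∃ f : E → ℝ, ∀ y ∈ Metric.ball x r, HasFDerivAt f (η y) y := by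
  intro x hx
  obtain ⟨r, hr, hrU⟩ := Metric.isOpen_iff.1 hU x hx
  exact ⟨r, hr, hrU, (convex_ball x r).exists_forall_hasFDerivAt_of_fderiv_symmetric
    Metric.isOpen_ball (hη.mono hrU) fun a ha => hclosed a (hrU ha)⟩

end Primitives

/-! ### Pressure fields -/

section Pressure

variable {U V : Set E3} {ξ : Fin 3 → E3 → ℝ} {p : E3 → ℝ}

/-- The one-form with the Cartesian components `ξ₀, ξ₁, ξ₂`. -/
noncomputable def oneForm (ξ : Fin 3 → E3 → ℝ) (x : E3) : E3 →L[ℝ] ℝ :=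
  ∑ a, ξ a x • (EuclideanSpace.proj a : E3 →L[ℝ] ℝ)

theorem oneForm_single (ξ : Fin 3 → E3 → ℝ) (x : E3) (a : Fin 3) :
    oneForm ξ x (EuclideanSpace.single a 1) = ξ a x := by
  simp [oneForm]

theorem contDiffOn_oneForm (hξ : ∀ a, ContDiffOn ℝ ∞ (ξ a) U) :
    ContDiffOn ℝ ∞ (oneForm ξ) U := by
  unfold oneForm
  exact ContDiffOn.sum fun a _ => (hξ a).smul contDiffOn_const

theorem fderiv_oneForm_symm (hU : IsOpen U) (hξ : ∀ a, ContDiffOn ℝ ∞ (ξ a) U)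
    (hcurl : ∀ x ∈ U, ∀ a b, pd b (ξ a) x = pd a (ξ b) x) {x : E3} (hx : x ∈ U) (v w : E3) :
    fderiv ℝ (oneForm ξ) x v w = fderiv ℝ (oneForm ξ) x w v := by
  have hd : ∀ a, DifferentiableAt ℝ (ξ a) x := fun a =>
    differentiableAt_of_contDiffOn (hξ a) hU hx
  have e : fderiv ℝ (oneForm ξ) x =
      ∑ a, (fderiv ℝ (ξ a) x).smulRight (EuclideanSpace.proj a : E3 →L[ℝ] ℝ) := by
    unfold oneForm
    exact (HasFDerivAt.fun_sum fun a _ => (hd a).hasFDerivAt.smul_const _).fderiv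
  have hv : ∀ (L : E3 →L[ℝ] ℝ) (v : E3), L v = ∑ b, v b * L (EuclideanSpace.single b 1) := by
    intro L v
    conv_lhs => rw [← (EuclideanSpace.basisFun (Fin 3) ℝ).sum_repr v]
    simp
  have hproj : ∀ (a : Fin 3) (v : E3), (EuclideanSpace.proj a : E3 →L[ℝ] ℝ) v = v a :=
    fun _ _ => rfl
  have hc := hcurl x hx
  simp only [pd] at hc
  simp only [e, sum_apply, ContinuousLinearMap.smulRight_apply,
    smul_eq_mul, FunLike.coe_smul, Pi.smul_apply, hproj]
  simp only [fun a => hv (fderiv ℝ (ξ a) x) v, fun a => hv (fderiv ℝ (ξ a) x) w,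
    Fin.sum_univ_three]
  rw [hc 0 1, hc 0 2, hc 1 2]
  ring

theorem contDiffOn_of_hasFDerivAt_oneForm (hV : IsOpen V) (hξ : ∀ a, ContDiffOn ℝ ∞ (ξ a) V)
    (hp : ∀ x ∈ V, HasFDerivAt p (oneForm ξ x) x) : ContDiffOn ℝ ∞ p V := by
  rw [contDiffOn_infty_iff_fderiv_of_isOpen hV]
  exact ⟨fun x hx => (hp x hx).differentiableAt.differentiableWithinAt,
    (contDiffOn_oneForm hξ).congr fun x hx => (hp x hx).fderiv⟩

theorem pd_eq_of_hasFDerivAt_oneForm {x : E3} (hp : HasFDerivAt p (oneForm ξ x) x) (a : Fin 3) :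
    pd a p x = ξ a x := by
  rw [pd, hp.fderiv, oneForm_single]

end Pressure

/-! ### Kinematics of an incompressible deformation -/

/-- The properties of the fields `b`, `c`, `I₁`, `I₂` of an incompressible deformation on the
current configuration `U` from which the universality constraints are analysed. -/
structure StrainFields (U : Set E3) (b c : E3 → Matrix (Fin 3) (Fin 3) ℝ) (I J : E3 → ℝ) :
    Prop where
  isOpen : IsOpen U
  b_smooth : ∀ a n, ContDiffOn ℝ ∞ (fun x => b x a n) U
  c_smooth : ∀ a n, ContDiffOn ℝ ∞ (fun x => c x a n) U
  b_symm : ∀ x ∈ U, ∀ a n, b x a n = b x n a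
  c_symm : ∀ x ∈ U, ∀ a n, c x a n = c x n a
  mul_eq_one : ∀ x ∈ U, b x * c x = 1
  det_eq_one : ∀ x ∈ U, (b x).det = 1
  I_eq : ∀ x, I x = (b x).trace
  J_eq : ∀ x, J x = (I x ^ 2 - (b x * b x).trace) / 2

namespace StrainFields

variable {U : Set E3} {b c : E3 → Matrix (Fin 3) (Fin 3) ℝ} {I J : E3 → ℝ}

theorem I_smooth (h : StrainFields U b c I J) : ContDiffOn ℝ ∞ I U := by
  have : I = fun x => ∑ n, b x n n := funext fun x => by rw [h.I_eq, Matrix.trace]; rfl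
  rw [this]
  exact ContDiffOn.sum fun n _ => h.b_smooth n n

theorem J_smooth (h : StrainFields U b c I J) : ContDiffOn ℝ ∞ J U := by
  have : J = fun x => (I x ^ 2 - ∑ n, ∑ m, b x n m * b x m n) / 2 := funext fun x => by
    rw [h.J_eq, Matrix.trace]
    simp only [Matrix.diag, Matrix.mul_apply]
  rw [this]
  exact ((h.I_smooth.pow 2).sub (ContDiffOn.sum fun n _ => ContDiffOn.sum fun m _ =>
    (h.b_smooth n m).mul (h.b_smooth m n))).div_const _

end StrainFields

section Kinematics

variable {Ω : Set E3} {φ : E3 → E3}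

theorem fderiv_apply_eq_pd {X : E3} (h : DifferentiableAt ℝ φ X) (a A : Fin 3) :
    fderiv ℝ φ X (EuclideanSpace.single A 1) a = pd A (fun Y => φ Y a) X := by
  have h1 := ((EuclideanSpace.proj a : E3 →L[ℝ] ℝ).hasFDerivAt.comp X h.hasFDerivAt).fderiv
  rw [pd, show (fun Y => φ Y a) = (EuclideanSpace.proj a : E3 →L[ℝ] ℝ) ∘ φ from rfl, h1]
  rfl

namespace IsIncompressibleDeformation

theorem materialPoint_apply (hφ : IsIncompressibleDeformation Ω φ) {X : E3} (hX : X ∈ Ω) :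
    materialPoint Ω φ (φ X) = X :=
  hφ.injective.leftInvOn_invFunOn hX

theorem contDiffAt (hφ : IsIncompressibleDeformation Ω φ) (hΩ : IsOpen Ω) {X : E3} (hX : X ∈ Ω) :
    ContDiffAt ℝ ∞ φ X :=
  hφ.smooth.contDiffAt (hΩ.mem_nhds hX)

theorem det_fderiv (hφ : IsIncompressibleDeformation Ω φ) (hΩ : IsOpen Ω) {X : E3} (hX : X ∈ Ω) :
    (fderiv ℝ φ X).det = 1 := by
  have hd := (hφ.contDiffAt hΩ hX).differentiableAt (by simp)
  rw [← hφ.det_eq_one X hX, ContinuousLinearMap.det,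
    ← LinearMap.det_toMatrix (EuclideanSpace.basisFun (Fin 3) ℝ).toBasis]
  congr 1
  ext a A
  rw [LinearMap.toMatrix_apply]
  simpa using fderiv_apply_eq_pd hd a A

theorem exists_equiv_hasStrictFDerivAt (hφ : IsIncompressibleDeformation Ω φ) (hΩ : IsOpen Ω)
    {X : E3} (hX : X ∈ Ω) : ∃ L : E3 ≃L[ℝ] E3, HasStrictFDerivAt φ (L : E3 →L[ℝ] E3) X := by
  refine ⟨(fderiv ℝ φ X).toContinuousLinearEquivOfDetNeZero (by simp [hφ.det_fderiv hΩ hX]), ?_⟩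
  rw [ContinuousLinearMap.coe_toContinuousLinearEquivOfDetNeZero]
  exact (hφ.contDiffAt hΩ hX).hasStrictFDerivAt (by simp)

theorem map_nhds (hφ : IsIncompressibleDeformation Ω φ) (hΩ : IsOpen Ω) {X : E3} (hX : X ∈ Ω) :
    Filter.map φ (nhds X) = nhds (φ X) := by
  obtain ⟨L, hL⟩ := hφ.exists_equiv_hasStrictFDerivAt hΩ hX
  exact hL.map_nhds_eq_of_equiv

theorem isOpen_image (hφ : IsIncompressibleDeformation Ω φ) (hΩ : IsOpen Ω) :
    IsOpen (φ '' Ω) := by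
  rw [isOpen_iff_mem_nhds]
  rintro _ ⟨X, hX, rfl⟩
  rw [← hφ.map_nhds hΩ hX]
  exact Filter.image_mem_map (hΩ.mem_nhds hX)

/-- An incompressible deformation as a homeomorphism of the body onto the current
configuration. -/
noncomputable def openPartialHomeomorph (hφ : IsIncompressibleDeformation Ω φ) (hΩ : IsOpen Ω) :
    OpenPartialHomeomorph E3 E3 where
  toPartialEquiv := hφ.injective.toPartialEquiv φ Ω
  open_source := hΩ
  open_target := hφ.isOpen_image hΩ
  continuousOn_toFun := hφ.smooth.continuousOn
  continuousOn_invFun := by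
    rintro _ ⟨X, hX, rfl⟩
    refine ContinuousAt.continuousWithinAt ?_
    change Filter.Tendsto (materialPoint Ω φ) (nhds (φ X)) (nhds (materialPoint Ω φ (φ X)))
    rw [← hφ.map_nhds hΩ hX, Filter.tendsto_map'_iff, hφ.materialPoint_apply hX]
    refine Filter.tendsto_id.congr' ?_
    filter_upwards [hΩ.mem_nhds hX] with Y hY using (hφ.materialPoint_apply hY).symm

theorem contDiffOn_materialPoint (hφ : IsIncompressibleDeformation Ω φ) (hΩ : IsOpen Ω) :
    ContDiffOn ℝ ∞ (materialPoint Ω φ) (φ '' Ω) := by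
  rintro _ ⟨X, hX, rfl⟩
  obtain ⟨L, hL⟩ := hφ.exists_equiv_hasStrictFDerivAt hΩ hX
  have hXX : (hφ.openPartialHomeomorph hΩ).symm (φ X) = X := hφ.materialPoint_apply hX
  have h := (hφ.openPartialHomeomorph hΩ).contDiffAt_symm (n := ∞) (f₀' := L) (a := φ X)
    ⟨X, hX, rfl⟩ (by rw [hXX]; exact hL.hasFDerivAt) (by rw [hXX]; exact hφ.contDiffAt hΩ hX)
  exact ContDiffAt.contDiffWithinAt h

theorem materialPoint_mem (hφ : IsIncompressibleDeformation Ω φ) {x : E3} (hx : x ∈ φ '' Ω) :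
    materialPoint Ω φ x ∈ Ω := by
  obtain ⟨X, hX, rfl⟩ := hx
  rwa [hφ.materialPoint_apply hX]

theorem contDiffOn_comp_materialPoint (hφ : IsIncompressibleDeformation Ω φ) (hΩ : IsOpen Ω)
    {F : Type*} [NormedAddCommGroup F] [NormedSpace ℝ F] {h : E3 → F} (hh : ContDiffOn ℝ ∞ h Ω) :
    ContDiffOn ℝ ∞ (fun x => h (materialPoint Ω φ x)) (φ '' Ω) :=
  hh.comp (hφ.contDiffOn_materialPoint hΩ) fun _ hx => hφ.materialPoint_mem hx

theorem isSimplyConnected_image (hφ : IsIncompressibleDeformation Ω φ) (hΩ : IsOpen Ω)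
    (hsc : IsSimplyConnected Ω) : IsSimplyConnected (φ '' Ω) := by
  let e : Ω ≃ₜ (φ '' Ω : Set E3) := (hφ.openPartialHomeomorph hΩ).toHomeomorphSourceTarget
  have := hsc.simplyConnectedSpace
  exact e.symm.toHomotopyEquiv.simplyConnectedSpace

theorem contDiffOn_defGrad (hφ : IsIncompressibleDeformation Ω φ) (hΩ : IsOpen Ω) (a A : Fin 3) :
    ContDiffOn ℝ ∞ (fun x => defGrad Ω φ x a A) (φ '' Ω) := by
  have h1 : ContDiffOn ℝ ∞ (fun Y => φ Y a) Ω :=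
    (EuclideanSpace.proj a : E3 →L[ℝ] ℝ).contDiff.comp_contDiffOn hφ.smooth
  exact hφ.contDiffOn_comp_materialPoint hΩ (contDiffOn_pd hΩ h1 A)

theorem det_defGrad (hφ : IsIncompressibleDeformation Ω φ) {x : E3} (hx : x ∈ φ '' Ω) :
    (defGrad Ω φ x).det = 1 :=
  hφ.det_eq_one _ (hφ.materialPoint_mem hx)

/-- Since `det F = 1`, the inverse deformation gradient is the adjugate, whose entries are
polynomials in those of `F`. -/
theorem contDiffOn_defGrad_inv (hφ : IsIncompressibleDeformation Ω φ) (hΩ : IsOpen Ω)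
    (A a : Fin 3) : ContDiffOn ℝ ∞ (fun x => (defGrad Ω φ x)⁻¹ A a) (φ '' Ω) := by
  have h := hφ.contDiffOn_defGrad hΩ
  have e : ∀ x ∈ φ '' Ω, (defGrad Ω φ x)⁻¹ A a = (defGrad Ω φ x).adjugate A a := by
    intro x hx
    rw [Matrix.inv_def, hφ.det_defGrad hx]
    simp
  refine ContDiffOn.congr ?_ e
  have key : ∀ M : Matrix (Fin 3) (Fin 3) ℝ, M.adjugate A a =
      (M.updateRow a (Pi.single A 1)).det := fun M => Matrix.adjugate_apply M A a
  simp only [key, Matrix.det_apply]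
  refine ContDiffOn.sum fun σ _ => ?_
  refine ContDiffOn.const_smul _ (contDiffOn_prod fun i _ => ?_)
  by_cases hi : σ i = a
  · simp only [hi, Matrix.updateRow_self]
    exact contDiffOn_const
  · simp only [Matrix.updateRow_ne hi]
    exact h _ _

theorem strainFields (hφ : IsIncompressibleDeformation Ω φ) (hΩ : IsOpen Ω) :
    StrainFields (φ '' Ω) (bField Ω φ) (cField Ω φ) (I1 Ω φ) (I2 Ω φ) where
  isOpen := hφ.isOpen_image hΩ
  b_smooth a n := by
    simp only [bField, Matrix.mul_apply, Matrix.transpose_apply]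
    exact ContDiffOn.sum fun A _ =>
      (hφ.contDiffOn_defGrad hΩ a A).mul (hφ.contDiffOn_defGrad hΩ n A)
  c_smooth a n := by
    simp only [cField, Matrix.mul_apply, Matrix.transpose_apply]
    exact ContDiffOn.sum fun A _ =>
      (hφ.contDiffOn_defGrad_inv hΩ A a).mul (hφ.contDiffOn_defGrad_inv hΩ A n)
  b_symm x _ a n := by
    simp only [bField, Matrix.mul_apply, Matrix.transpose_apply]
    exact Finset.sum_congr rfl fun A _ => mul_comm _ _
  c_symm x _ a n := by
    simp only [cField, Matrix.mul_apply, Matrix.transpose_apply]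
    exact Finset.sum_congr rfl fun A _ => mul_comm _ _
  mul_eq_one x hx := by
    have hu : IsUnit (defGrad Ω φ x).det := by rw [hφ.det_defGrad hx]; exact isUnit_one
    have hu' : IsUnit (defGrad Ω φ x).transpose.det := by rwa [Matrix.det_transpose]
    rw [bField, cField, Matrix.transpose_nonsing_inv, Matrix.mul_assoc,
      Matrix.mul_nonsing_inv_cancel_left _ _ hu', Matrix.mul_nonsing_inv _ hu]
  det_eq_one x hx := by
    rw [bField, Matrix.det_mul, Matrix.det_transpose, hφ.det_defGrad hx, one_mul]
  I_eq _ := rfl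
  J_eq _ := rfl

end IsIncompressibleDeformation

end Kinematics

/-! ### Pointwise linear algebra of the quadratic constraints -/

section LinearAlgebra

open Matrix

variable {M N : Matrix (Fin 3) (Fin 3) ℝ} {u v : Fin 3 → ℝ} {l : ℝ}

theorem vecMul_eq_smul_of_parallel (hu : ∀ a b, (u ᵥ* M) a * u b = (u ᵥ* M) b * u a) {k : Fin 3}
    (hk : u k ≠ 0) : u ᵥ* M = ((u ᵥ* M) k / u k) • u := by
  funext a
  rw [Pi.smul_apply, smul_eq_mul, div_mul_eq_mul_div, eq_div_iff hk, hu]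

/-- An eigenvector of a matrix is an eigenvector of its inverse. -/
theorem parallel_vecMul_inverse (hMN : M * N = 1)
    (hu : ∀ a b, (u ᵥ* M) a * u b = (u ᵥ* M) b * u a) (a b : Fin 3) :
    (u ᵥ* N) a * u b = (u ᵥ* N) b * u a := by
  by_cases h0 : u = 0
  · simp [h0]
  obtain ⟨k, hk⟩ := Function.ne_iff.1 h0
  set l := (u ᵥ* M) k / u k
  have h1 : u = l • (u ᵥ* N) := by
    rw [← smul_vecMul, ← vecMul_eq_smul_of_parallel hu hk, vecMul_vecMul, hMN, vecMul_one]
  have h2 : ∀ n, u n = l * (u ᵥ* N) n := fun n => congrFun h1 n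
  linear_combination (u ᵥ* N) a * h2 b - (u ᵥ* N) b * h2 a

/-- The symmetry of `uM ⊗ v + vM ⊗ u` forces two linearly independent eigenvectors `u`, `v` to have
the same eigenvalue. -/
theorem vecMul_eq_smul_of_mixed (hu : ∀ a b, (u ᵥ* M) a * u b = (u ᵥ* M) b * u a)
    (hv : ∀ a b, (v ᵥ* M) a * v b = (v ᵥ* M) b * v a)
    (huv : ∀ a b, (u ᵥ* M) a * v b + (v ᵥ* M) a * u b = (u ᵥ* M) b * v a + (v ᵥ* M) b * u a)
    {k i j : Fin 3} (hk : u k ≠ 0) (hij : u i * v j - u j * v i ≠ 0) :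
    v ᵥ* M = ((u ᵥ* M) k / u k) • v := by
  have h1 := vecMul_eq_smul_of_parallel hu hk
  set l := (u ᵥ* M) k / u k
  have h2 : ∀ a, (u ᵥ* M) a = l * u a := fun a => congrFun h1 a
  set w := v ᵥ* M
  have h3 : ∀ a b, (w a - l * v a) * u b = (w b - l * v b) * u a := by
    intro a b
    have := huv a b
    rw [h2, h2] at this
    linear_combination this
  set s := (w k - l * v k) / u k
  have h4 : ∀ a, w a = l * v a + s * u a := by
    intro a
    have : w a - l * v a = s * u a := by
      rw [show s * u a = (w k - l * v k) * u a / u k from div_mul_eq_mul_div .., eq_div_iff hk, h3]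
    linear_combination this
  have h5 : s * (u i * v j - u j * v i) = 0 := by
    have := hv i j
    rw [h4, h4] at this
    linear_combination this
  have h6 : s = 0 := (mul_eq_zero.1 h5).resolve_right hij
  funext a
  rw [h4, h6, Pi.smul_apply, smul_eq_mul]
  ring

/-- An eigenvalue with two linearly independent eigenvectors is a double root of the
characteristic polynomial. -/
theorem charpoly_double_root (hu : u ᵥ* M = l • u) (hv : v ᵥ* M = l • v) {i j : Fin 3}
    (hij : u i * v j - u j * v i ≠ 0) :
    l ^ 3 - M.trace * l ^ 2 + (M.trace ^ 2 - (M * M).trace) / 2 * l - M.det = 0 ∧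
      3 * l ^ 2 - 2 * M.trace * l + (M.trace ^ 2 - (M * M).trace) / 2 = 0 := by
  -- The columns of `M - l` are multiples of the cross product `w` of `u` and `v`.
  obtain ⟨w, hw⟩ : ∃ w : Fin 3 → ℝ, w = ![u 1 * v 2 - u 2 * v 1, u 2 * v 0 - u 0 * v 2,
    u 0 * v 1 - u 1 * v 0] := ⟨_, rfl⟩
  have w0 : w 0 = u 1 * v 2 - u 2 * v 1 := by rw [hw]; rfl
  have w1 : w 1 = u 2 * v 0 - u 0 * v 2 := by rw [hw]; rfl
  have w2 : w 2 = u 0 * v 1 - u 1 * v 0 := by rw [hw]; rfl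
  obtain ⟨k, hk⟩ : ∃ k, w k ≠ 0 := by
    by_contra! h
    apply hij
    have h0 := w0 ▸ h 0
    have h1 := w1 ▸ h 1
    have h2 := w2 ▸ h 2
    fin_cases i <;> fin_cases j <;> simp only [Fin.zero_eta, Fin.mk_one, Fin.reduceFinMk] <;>
      linarith
  have hu' : ∀ a, u 0 * M 0 a + u 1 * M 1 a + u 2 * M 2 a = l * u a := fun a => by
    have := congrFun hu a
    simpa [vecMul, dotProduct, Fin.sum_univ_three] using this
  have hv' : ∀ a, v 0 * M 0 a + v 1 * M 1 a + v 2 * M 2 a = l * v a := fun a => by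
    have := congrFun hv a
    simpa [vecMul, dotProduct, Fin.sum_univ_three] using this
  obtain ⟨P, hP⟩ : ∃ P : Fin 3 → Fin 3 → ℝ, ∀ n a, P n a = M n a - l * if n = a then 1 else 0 :=
    ⟨_, fun _ _ => rfl⟩
  have hPu : ∀ a, u 0 * P 0 a + u 1 * P 1 a + u 2 * P 2 a = 0 := by
    intro a
    have := hu' a
    simp only [hP]
    fin_cases a <;> simp at this ⊢ <;> linarith
  have hPv : ∀ a, v 0 * P 0 a + v 1 * P 1 a + v 2 * P 2 a = 0 := by
    intro a
    have := hv' a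
    simp only [hP]
    fin_cases a <;> simp at this ⊢ <;> linarith
  have e01 : ∀ a, P 0 a * w 1 = P 1 a * w 0 := fun a => by
    rw [w0, w1]; linear_combination u 2 * hPv a - v 2 * hPu a
  have e12 : ∀ a, P 1 a * w 2 = P 2 a * w 1 := fun a => by
    rw [w1, w2]; linear_combination u 0 * hPv a - v 0 * hPu a
  have e20 : ∀ a, P 2 a * w 0 = P 0 a * w 2 := fun a => by
    rw [w0, w2]; linear_combination u 1 * hPv a - v 1 * hPu a
  have hPw : ∀ n m a, P n a * w m = P m a * w n := by
    intro n m a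
    fin_cases n <;> fin_cases m <;> simp only [Fin.zero_eta, Fin.mk_one, Fin.reduceFinMk] <;>
      linarith [e01 a, e12 a, e20 a]
  obtain ⟨r, hr⟩ : ∃ r : Fin 3 → ℝ, ∀ n a, P n a = w n * r a :=
    ⟨fun a => P k a / w k, fun n a => by rw [← mul_div_assoc, eq_div_iff hk, hPw, mul_comm]⟩
  have hM : ∀ n a, M n a = w n * r a + l * if n = a then 1 else 0 := fun n a => by
    linear_combination hr n a - hP n a
  constructor <;>
  · simp only [det_fin_three, trace_fin_three, mul_apply, Fin.sum_univ_three, hM]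
    simp
    ring

end LinearAlgebra

/-! ### Gradients of the invariants -/

section Gradients

open Matrix

variable {U : Set E3} {b c T : E3 → Matrix (Fin 3) (Fin 3) ℝ} {I J g h : E3 → ℝ} {x : E3}

/-- The gradient `∂h/∂xⁿ`. -/
noncomputable def grad (h : E3 → ℝ) (x : E3) (n : Fin 3) : ℝ := pd n h x

theorem mixedCoeff_eq (T : E3 → Matrix (Fin 3) (Fin 3) ℝ) (g h : E3 → ℝ) (x : E3) (i j : Fin 3) :
    mixedCoeff T g h x i j =
      (grad g x ᵥ* T x) i * grad h x j + (grad h x ᵥ* T x) i * grad g x j := by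
  simp only [mixedCoeff, vecMul, dotProduct, grad, Fin.sum_univ_three]
  ring

theorem pureCoeff_eq (T : E3 → Matrix (Fin 3) (Fin 3) ℝ) (g : E3 → ℝ) (x : E3) (i j : Fin 3) :
    pureCoeff T g x i j = (grad g x ᵥ* T x) i * grad g x j := by
  simp only [pureCoeff, vecMul, dotProduct, grad, Fin.sum_univ_three]
  ring

/-- The constraints quadratic in the gradients of the invariants do not distinguish a tensor field
from its inverse. -/
theorem SymmetricOn.pureCoeff_inverse (hbc : ∀ x ∈ U, b x * c x = 1)
    (h : SymmetricOn U (pureCoeff b I)) : SymmetricOn U (pureCoeff c I) := by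
  intro x hx i j
  simp only [SymmetricOn, pureCoeff_eq] at h ⊢
  exact parallel_vecMul_inverse (hbc x hx) (h x hx) i j

/-- If `∇g` is an eigenvector of `T` near `x`, with eigenvalue `l`, then the skew part of
`firstCoeff T g` is `∇g ∧ (div T - ∇l)`. -/
theorem firstCoeff_sub_of_eigenvector (hU : IsOpen U) (hg : ContDiffOn ℝ ∞ g U) (hx : x ∈ U)
    {l : E3 → ℝ} (hl : DifferentiableAt ℝ l x)
    (heig : ∀ᶠ y in nhds x, grad g y ᵥ* T y = l y • grad g y) (i j : Fin 3) :
    firstCoeff T g x i j - firstCoeff T g x j i =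
      grad g x j * (div1 T i x - pd i l x) - grad g x i * (div1 T j x - pd j l x) := by
  have hgn : ∀ n, DifferentiableAt ℝ (pd n g) x := fun n =>
    differentiableAt_of_contDiffOn (contDiffOn_pd hU hg n) hU hx
  have e : ∀ i j, pd j (fun y => ∑ n, T y n i * pd n g y) x =
      l x * pd j (pd i g) x + pd i g x * pd j l x := by
    intro i j
    rw [← pd_mul hl (hgn i)]
    refine pd_congr ?_ j
    filter_upwards [heig] with y hy
    have := congrFun hy i
    simp only [vecMul, dotProduct, grad, Pi.smul_apply, smul_eq_mul] at this
    rw [← this]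
    exact Finset.sum_congr rfl fun n _ => mul_comm _ _
  simp only [firstCoeff, e, grad]
  rw [pd_comm hU hg hx i j]
  ring

theorem continuousAt_pd (hU : IsOpen U) (hg : ContDiffOn ℝ ∞ g U) (hx : x ∈ U) (n : Fin 3) :
    ContinuousAt (pd n g) x :=
  (differentiableAt_of_contDiffOn (contDiffOn_pd hU hg n) hU hx).continuousAt

/-- If `∇g` is an eigenvector of `T`, this quotient is the eigenvalue. -/
theorem differentiableAt_eigenvalue (hU : IsOpen U)
    (hT : ∀ a n, ContDiffOn ℝ ∞ (fun y => T y a n) U) (hg : ContDiffOn ℝ ∞ g U) (hx : x ∈ U)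
    {k : Fin 3} (hk : grad g x k ≠ 0) :
    DifferentiableAt ℝ (fun y => (grad g y ᵥ* T y) k / grad g y k) x := by
  have hgn : ∀ n, DifferentiableAt ℝ (pd n g) x := fun n =>
    differentiableAt_of_contDiffOn (contDiffOn_pd hU hg n) hU hx
  have hd : DifferentiableAt ℝ (fun y => grad g y k) x := hgn k
  have hn : DifferentiableAt ℝ (fun y => (grad g y ᵥ* T y) k) x := by
    simp only [vecMul, dotProduct, grad]
    exact DifferentiableAt.fun_sum fun n _ => (hgn n).fun_mul
      (differentiableAt_of_contDiffOn (hT n k) hU hx)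
  simp only [div_eq_mul_inv]
  exact hn.fun_mul (hd.fun_inv hk)

theorem firstCoeff_eq_zero_of_grad_eq_zero (hg : ∀ᶠ y in nhds x, ∀ n, pd n g y = 0)
    (i j : Fin 3) : firstCoeff T g x i j = 0 := by
  have e : pd j (fun y => ∑ n, T y n i * pd n g y) x = pd j (fun _ => 0) x := by
    refine pd_congr ?_ j
    filter_upwards [hg] with y hy
    simp [hy]
  rw [firstCoeff, e, pd_const, hg.self_of_nhds j]
  ring

theorem continuousAt_firstCoeff (hU : IsOpen U)
    (hT : ∀ a n, ContDiffOn ℝ ∞ (fun y => T y a n) U) (hg : ContDiffOn ℝ ∞ g U) (hx : x ∈ U)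
    (i j : Fin 3) : ContinuousAt (fun y => firstCoeff T g y i j) x := by
  have h1 : ContDiffOn ℝ ∞ (fun y => ∑ n, T y n i * pd n g y) U :=
    ContDiffOn.sum fun n _ => (hT n i).mul (contDiffOn_pd hU hg n)
  refine ((continuousAt_pd hU hg hx j).mul ?_).add (continuousAt_pd hU h1 hx j)
  unfold div1
  exact tendsto_finsetSum _ fun n _ => continuousAt_pd hU (hT n i) hx n

namespace StrainFields

/-- The gradients of the invariants are parallel. Where they were not, they would be eigenvectors
of `b` with a common eigenvalue, a double root of the characteristic polynomial
`l³ - I₁ l² + I₂ l - 1`. Differentiating this equation gives `∇I₂ = l ∇I₁`. -/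
theorem grad_parallel (h : StrainFields U b c I J) (hI : SymmetricOn U (pureCoeff b I))
    (hJ : SymmetricOn U (pureCoeff b J)) (hIJ : SymmetricOn U (mixedCoeff b I J)) (hx : x ∈ U)
    (i j : Fin 3) : grad I x i * grad J x j = grad I x j * grad J x i := by
  by_contra hne
  have hij : grad I x i * grad J x j - grad I x j * grad J x i ≠ 0 := sub_ne_zero.2 hne
  have hU := h.isOpen
  obtain ⟨k, hk⟩ : ∃ k, grad I x k ≠ 0 := by
    by_contra! h0
    simp [h0] at hij
  have cI := fun n => continuousAt_pd hU h.I_smooth hx n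
  have cJ := fun n => continuousAt_pd hU h.J_smooth hx n
  have hnear : ∀ᶠ y in nhds x, y ∈ U ∧ grad I y k ≠ 0 ∧
      grad I y i * grad J y j - grad I y j * grad J y i ≠ 0 :=
    (hU.eventually_mem hx).and (((cI k).eventually_ne hk).and
      ((((cI i).mul (cJ j)).sub ((cI j).mul (cJ i))).eventually_ne hij))
  set l : E3 → ℝ := fun y => (grad I y ᵥ* b y) k / grad I y k with hl
  have hroot : ∀ᶠ y in nhds x,
      l y * (l y * l y) - I y * (l y * l y) + J y * l y - 1 = 0 ∧
        3 * (l y * l y) - 2 * (I y * l y) + J y = 0 := by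
    filter_upwards [hnear] with y ⟨hyU, hyk, hyij⟩
    simp only [SymmetricOn, pureCoeff_eq, mixedCoeff_eq] at hI hJ hIJ
    have := charpoly_double_root (vecMul_eq_smul_of_parallel (hI y hyU) hyk)
      (vecMul_eq_smul_of_mixed (hI y hyU) (hJ y hyU) (hIJ y hyU) hyk hyij) hyij
    rw [h.det_eq_one y hyU, ← h.I_eq, ← h.J_eq] at this
    constructor
    · linear_combination this.1
    · linear_combination this.2
  have dl : DifferentiableAt ℝ l x :=
    differentiableAt_eigenvalue hU h.b_smooth h.I_smooth hx hk
  have dI := differentiableAt_of_contDiffOn h.I_smooth hU hx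
  have dJ := differentiableAt_of_contDiffOn h.J_smooth hU hx
  obtain ⟨r1, r2⟩ := hroot.self_of_nhds
  have hl0 : l x ≠ 0 := by
    intro h0
    rw [h0] at r1
    norm_num at r1
  have key : ∀ n, pd n J x = l x * pd n I x := by
    intro n
    have e := pd_congr (hroot.mono fun y hy => hy.1) n
    rw [pd_sub_const, pd_const, pd_add ((dl.fun_mul (dl.fun_mul dl)).fun_sub
      (dI.fun_mul (dl.fun_mul dl))) (dJ.fun_mul dl), pd_sub (dl.fun_mul (dl.fun_mul dl))
      (dI.fun_mul (dl.fun_mul dl)), pd_mul dl (dl.fun_mul dl), pd_mul dI (dl.fun_mul dl),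
      pd_mul dJ dl, pd_mul dl dl] at e
    have : l x * (pd n J x - l x * pd n I x) = 0 := by
      linear_combination e - pd n l x * r2
    linear_combination (mul_eq_zero.1 this).resolve_left hl0
  apply hne
  simp only [grad, key]
  ring

/-- Where `∇I₁ ≠ 0`, the parallel vectors `∇I₁` and `∇I₂` are eigenvectors of `b` with the same
eigenvalue, and the first-order constraint on `∇I₁` carries over to `∇I₂`. -/
theorem firstCoeff_comm_of_grad_ne_zero (h : StrainFields U b c I J)
    (hI : SymmetricOn U (pureCoeff b I))
    (hpar : ∀ x ∈ U, ∀ i j, grad I x i * grad J x j = grad I x j * grad J x i)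
    (hfirst : SymmetricOn U (firstCoeff b I)) (hx : x ∈ U)
    (hIx : ∃ k, pd k I x ≠ 0) (i j : Fin 3) :
    firstCoeff b J x i j = firstCoeff b J x j i := by
  obtain ⟨k, hk⟩ := hIx
  have hU := h.isOpen
  set l : E3 → ℝ := fun y => (grad I y ᵥ* b y) k / grad I y k with hl
  have dl : DifferentiableAt ℝ l x :=
    differentiableAt_eigenvalue hU h.b_smooth h.I_smooth hx hk
  simp only [SymmetricOn, pureCoeff_eq] at hI
  have hnear : ∀ᶠ y in nhds x, y ∈ U ∧ grad I y k ≠ 0 :=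
    (hU.eventually_mem hx).and ((continuousAt_pd hU h.I_smooth hx k).eventually_ne hk)
  have hJI : ∀ y ∈ U, grad I y k ≠ 0 → grad J y = (grad J y k / grad I y k) • grad I y := by
    intro y hy hyk
    funext a
    rw [Pi.smul_apply, smul_eq_mul, div_mul_eq_mul_div, eq_div_iff hyk]
    linear_combination hpar y hy k a
  have eI : ∀ᶠ y in nhds x, grad I y ᵥ* b y = l y • grad I y := by
    filter_upwards [hnear] with y ⟨hy, hyk⟩
    exact vecMul_eq_smul_of_parallel (hI y hy) hyk
  have eJ : ∀ᶠ y in nhds x, grad J y ᵥ* b y = l y • grad J y := by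
    filter_upwards [hnear, eI] with y ⟨hy, hyk⟩ hyI
    rw [hJI y hy hyk, smul_vecMul, hyI, smul_comm]
  have sI := firstCoeff_sub_of_eigenvector hU h.I_smooth hx dl eI i j
  have sJ := firstCoeff_sub_of_eigenvector hU h.J_smooth hx dl eJ i j
  rw [hfirst x hx i j, sub_self] at sI
  rw [hJI x hx hk] at sJ
  simp only [Pi.smul_apply, smul_eq_mul] at sJ
  linear_combination sJ - (grad J x k / grad I x k) * sI

/-- The coupled first-order constraint decouples. A point where the skew part of `firstCoeff b J`
does not vanish has a neighbourhood of such points; there `∇I₁ = 0`, so that the term with `c`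
vanishes identically and leaves the constraint for `firstCoeff b J` alone. -/
theorem firstCoeff_symmetricOn (h : StrainFields U b c I J)
    (hI : SymmetricOn U (pureCoeff b I))
    (hpar : ∀ x ∈ U, ∀ i j, grad I x i * grad J x j = grad I x j * grad J x i)
    (hfirst : SymmetricOn U (firstCoeff b I))
    (hcoupled : SymmetricOn U fun x i j => firstCoeff b J x i j - firstCoeff c I x i j) :
    SymmetricOn U (firstCoeff b J) := by
  intro x hx i j
  by_contra hne
  have hU := h.isOpen
  have cK := fun i j => continuousAt_firstCoeff hU h.b_smooth h.J_smooth hx i j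
  have hnear : ∀ᶠ y in nhds x, y ∈ U ∧ firstCoeff b J y i j - firstCoeff b J y j i ≠ 0 :=
    (hU.eventually_mem hx).and (((cK i j).sub (cK j i)).eventually_ne (sub_ne_zero.2 hne))
  have hne0 : ∀ y ∈ U, firstCoeff b J y i j - firstCoeff b J y j i ≠ 0 → ∀ k, pd k I y = 0 := by
    intro y hy hyne
    by_contra! hk
    exact hyne (sub_eq_zero.2 (h.firstCoeff_comm_of_grad_ne_zero hI hpar hfirst hy hk i j))
  have hzero : ∀ᶠ y in nhds x, ∀ k, pd k I y = 0 := hnear.mono fun y hy => hne0 y hy.1 hy.2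
  have hc := hcoupled x hx i j
  simp only [firstCoeff_eq_zero_of_grad_eq_zero hzero, sub_zero] at hc
  exact hne hc

end StrainFields

end Gradients

/-! ### Equilibrium and the curl of the pressure gradient -/

section Equilibrium

variable {Ω V : Set E3} {φ : E3 → E3} {m : Material} {p : E3 → ℝ} {x : E3}

/-- The components of the extra stress of the material `m` are smooth on the current
configuration. -/
def SmoothExtraStress (Ω : Set E3) (φ : E3 → E3) (m : Material) : Prop :=
  ∀ a n, ContDiffOn ℝ ∞ (fun x => extraStress Ω φ m x a n) (φ '' Ω)

theorem SmoothExtraStress.contDiffOn_divergence (hU : IsOpen (φ '' Ω))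
    (hm : SmoothExtraStress Ω φ m) (a : Fin 3) :
    ContDiffOn ℝ ∞ (fun y => divergence (extraStress Ω φ m) y a) (φ '' Ω) :=
  ContDiffOn.sum fun n _ => contDiffOn_pd hU (hm a n) n

theorem divergence_cauchyStress
    (hm : ∀ a n, DifferentiableAt ℝ (fun y => extraStress Ω φ m y a n) x)
    (hp : DifferentiableAt ℝ p x) (a : Fin 3) :
    divergence (cauchyStress Ω φ m p) x a = divergence (extraStress Ω φ m) x a - pd a p x := by
  have e : ∀ n, pd n (fun y => cauchyStress Ω φ m p y a n) x =
      pd n (fun y => extraStress Ω φ m y a n) x -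
        (1 : Matrix (Fin 3) (Fin 3) ℝ) a n * pd n p x := by
    intro n
    rw [← pd_const_mul, ← pd_sub (hm a n) (hp.const_mul _)]
    congr 1
    funext y
    simp only [cauchyStress, Matrix.add_apply, Matrix.neg_apply, Matrix.smul_apply, smul_eq_mul]
    ring
  simp only [divergence, e, Finset.sum_sub_distrib, Matrix.one_apply, ite_mul, one_mul, zero_mul,
    Finset.sum_ite_eq, Finset.mem_univ, if_true]

/-- Equilibrium determines the pressure gradient: `∂p/∂xᵃ = ξ_a`. -/
theorem equilibriumOn_iff (hV : IsOpen V) (hVU : V ⊆ φ '' Ω)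
    (hm : SmoothExtraStress Ω φ m) :
    EquilibriumOn V Ω φ m p ↔ ContDiffOn ℝ ∞ p V ∧
      ∀ x ∈ V, ∀ a, pd a p x = divergence (extraStress Ω φ m) x a := by
  refine and_congr_right fun hp => forall₂_congr fun x hx => forall_congr' fun a => ?_
  rw [divergence_cauchyStress (fun a n =>
    differentiableAt_of_contDiffOn ((hm a n).mono hVU) hV hx)
    (differentiableAt_of_contDiffOn hp hV hx), sub_eq_zero, eq_comm]

theorem curlFree_of_admitsLocalEquilibrium (hm : SmoothExtraStress Ω φ m)
    (h : AdmitsLocalEquilibrium Ω φ m) : CurlFreePressureGradient Ω φ m := by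
  intro x hx a b
  obtain ⟨V, hV, hxV, hVU, p, hp⟩ := h x hx
  obtain ⟨hps, hpd⟩ := (equilibriumOn_iff hV hVU hm).1 hp
  rw [pd_congr_of_eqOn hV hxV fun y hy => (hpd y hy a).symm,
    pd_congr_of_eqOn hV hxV fun y hy => (hpd y hy b).symm]
  exact pd_comm hV hps hxV b a

theorem equilibriumOn_of_primitive (hV : IsOpen V) (hVU : V ⊆ φ '' Ω) (hU : IsOpen (φ '' Ω))
    (hm : SmoothExtraStress Ω φ m)
    (hp : ∀ y ∈ V, HasFDerivAt p
      (oneForm (fun a y => divergence (extraStress Ω φ m) y a) y) y) :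
    EquilibriumOn V Ω φ m p :=
  (equilibriumOn_iff hV hVU hm).2 ⟨contDiffOn_of_hasFDerivAt_oneForm hV
    (fun a => (hm.contDiffOn_divergence hU a).mono hVU) hp,
    fun y hy a => pd_eq_of_hasFDerivAt_oneForm (hp y hy) a⟩

theorem exists_local_primitive (hU : IsOpen (φ '' Ω)) (hm : SmoothExtraStress Ω φ m)
    (h : CurlFreePressureGradient Ω φ m) :
    ∀ x ∈ φ '' Ω, ∃ r > 0, Metric.ball x r ⊆ φ '' Ω ∧ ∃ p : E3 → ℝ, ∀ y ∈ Metric.ball x r,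
      HasFDerivAt p (oneForm (fun a y => divergence (extraStress Ω φ m) y a) y) y := by
  have hξ := hm.contDiffOn_divergence hU
  exact exists_primitive_ball hU ((contDiffOn_oneForm hξ).differentiableOn (by simp))
    fun x hx v w => fderiv_oneForm_symm hU hξ h hx v w

theorem admitsLocalEquilibrium_iff (hU : IsOpen (φ '' Ω)) (hm : SmoothExtraStress Ω φ m) :
    AdmitsLocalEquilibrium Ω φ m ↔ CurlFreePressureGradient Ω φ m := by
  refine ⟨curlFree_of_admitsLocalEquilibrium hm, fun h x hx => ?_⟩
  obtain ⟨r, hr, hrU, p, hp⟩ := exists_local_primitive hU hm h x hx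
  exact ⟨Metric.ball x r, Metric.isOpen_ball, Metric.mem_ball_self hr, hrU, p,
    equilibriumOn_of_primitive Metric.isOpen_ball hrU hU hm hp⟩

theorem admitsEquilibrium_iff (hU : IsOpen (φ '' Ω)) (hsc : IsSimplyConnected (φ '' Ω))
    (hm : SmoothExtraStress Ω φ m) :
    AdmitsEquilibrium Ω φ m ↔ CurlFreePressureGradient Ω φ m := by
  constructor
  · rintro ⟨p, hp⟩
    exact curlFree_of_admitsLocalEquilibrium hm fun x hx => ⟨φ '' Ω, hU, hx, subset_rfl, p, hp⟩
  · intro h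
    obtain ⟨p, hp⟩ := exists_primitive_of_locally hU hsc (exists_local_primitive hU hm h)
    exact ⟨p, equilibriumOn_of_primitive hU subset_rfl hU hm hp⟩

end Equilibrium

/-! ### Classes of materials -/

section Materials

variable {Ω : Set E3} {φ : E3 → E3} {m : Material}

/-- Homogeneous materials are inhomogeneous ones for the empty family of inhomogeneities. -/
theorem cauchyMaterials_eq (f : E3 → Fin 0 → ℝ) : cauchyMaterials = inhomCauchyMaterials f := by
  ext m
  constructor
  · rintro ⟨β, γ, hβ, hγ, rfl⟩
    exact ⟨fun _ => β, fun _ => γ, hβ.comp contDiff_snd, hγ.comp contDiff_snd, rfl⟩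
  · rintro ⟨β, γ, hβ, hγ, rfl⟩
    have hf : ∀ X, f X = 0 := fun X => Subsingleton.elim _ _
    refine ⟨β 0, γ 0, hβ.comp (contDiff_const.prodMk contDiff_id),
      hγ.comp (contDiff_const.prodMk contDiff_id), ?_⟩
    simp only [hf]

theorem hyperelasticMaterials_eq (f : E3 → Fin 0 → ℝ) :
    hyperelasticMaterials = inhomHyperelasticMaterials f := by
  ext m
  constructor
  · rintro ⟨W, hW, rfl⟩
    exact ⟨fun _ => W, hW.comp contDiff_snd, rfl⟩
  · rintro ⟨W, hW, rfl⟩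
    have hf : ∀ X, f X = 0 := fun X => Subsingleton.elim _ _
    refine ⟨W 0, hW.comp (contDiff_const.prodMk contDiff_id), ?_⟩
    simp only [hf]

/-- Hyperelastic materials are Cauchy elastic. -/
theorem inhomHyperelasticMaterials_subset {k : ℕ} (f : E3 → Fin k → ℝ) :
    inhomHyperelasticMaterials f ⊆ inhomCauchyMaterials f := by
  rintro _ ⟨W, hW, rfl⟩
  have hd : ∀ q : (Fin k → ℝ) × ℝ × ℝ, HasFDerivAt
      (fun q : (Fin k → ℝ) × ℝ × ℝ => W q.1 q.2.1 q.2.2)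
      (fderiv ℝ (fun q : (Fin k → ℝ) × ℝ × ℝ => W q.1 q.2.1 q.2.2) q) q := fun q =>
    (hW.contDiffAt.differentiableAt (by simp)).hasFDerivAt
  have hs : ∀ v : (Fin k → ℝ) × ℝ × ℝ, ContDiff ℝ ∞ fun q : (Fin k → ℝ) × ℝ × ℝ =>
      fderiv ℝ (fun q : (Fin k → ℝ) × ℝ × ℝ => W q.1 q.2.1 q.2.2) q v := fun v =>
    (hW.fderiv_right (by simp)).clm_apply contDiff_const
  have e1 : ∀ q i j, deriv (fun t => W q t j) i =
      fderiv ℝ (fun q : (Fin k → ℝ) × ℝ × ℝ => W q.1 q.2.1 q.2.2) (q, i, j) (0, 1, 0) := by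
    intro q i j
    have hc : HasDerivAt (fun t : ℝ => (q, t, j)) ((0 : Fin k → ℝ), (1 : ℝ), (0 : ℝ)) i :=
      (hasDerivAt_const _ _).prodMk ((hasDerivAt_id i).prodMk (hasDerivAt_const _ _))
    exact ((hd (q, i, j)).comp_hasDerivAt i hc).deriv
  have e2 : ∀ q i j, deriv (fun t => W q i t) j =
      fderiv ℝ (fun q : (Fin k → ℝ) × ℝ × ℝ => W q.1 q.2.1 q.2.2) (q, i, j) (0, 0, 1) := by
    intro q i j
    have hc : HasDerivAt (fun t : ℝ => (q, i, t)) ((0 : Fin k → ℝ), (0 : ℝ), (1 : ℝ)) j :=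
      (hasDerivAt_const _ _).prodMk ((hasDerivAt_const _ _).prodMk (hasDerivAt_id j))
    exact ((hd (q, i, j)).comp_hasDerivAt j hc).deriv
  refine ⟨fun q i j => 2 * deriv (fun t => W q t j) i, fun q i j => -2 * deriv (fun t => W q i t) j,
    ?_, ?_, rfl⟩
  · simp only [e1]
    exact contDiff_const.mul (hs _)
  · simp only [e2]
    exact contDiff_const.mul (hs _)

theorem hyperelasticMaterials_subset : hyperelasticMaterials ⊆ cauchyMaterials := by
  rw [cauchyMaterials_eq fun _ => 0, hyperelasticMaterials_eq fun _ => 0]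
  exact inhomHyperelasticMaterials_subset _

/-- The coefficient `B` of `b` and the coefficient `G` of `c` in the extra stress, as fields on the
current configuration, enter the derivative `ξ_{a|b}` of the pressure gradient in this way. -/
noncomputable def curlCoeff (b c : E3 → Matrix (Fin 3) (Fin 3) ℝ) (B G : E3 → ℝ)
    (x : E3) (i j : Fin 3) : ℝ :=
  inhomCoeff b B x i j + B x * hessDiv b x i j + (inhomCoeff c G x i j + G x * hessDiv c x i j)

theorem pd_divergence_add {U : Set E3} {b c : E3 → Matrix (Fin 3) (Fin 3) ℝ} {I J B G : E3 → ℝ}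
    (h : StrainFields U b c I J) (hB : ContDiffOn ℝ ∞ B U) (hG : ContDiffOn ℝ ∞ G U) {x : E3}
    (hx : x ∈ U) (i j : Fin 3) :
    pd j (fun y => divergence (fun z => B z • b z + G z • c z) y i) x =
      curlCoeff b c B G x i j := by
  have hU := h.isOpen
  have sb : ∀ n, ContDiffOn ℝ ∞ (fun z => (B z • b z) i n) U := fun n => hB.mul (h.b_smooth i n)
  have sc : ∀ n, ContDiffOn ℝ ∞ (fun z => (G z • c z) i n) U := fun n => hG.mul (h.c_smooth i n)
  have e : ∀ y ∈ U, divergence (fun z => B z • b z + G z • c z) y i =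
      divergence (fun z => B z • b z) y i + divergence (fun z => G z • c z) y i := by
    intro y hy
    simp only [divergence, ← Finset.sum_add_distrib]
    refine Finset.sum_congr rfl fun n _ => ?_
    exact pd_add (differentiableAt_of_contDiffOn (sb n) hU hy)
      (differentiableAt_of_contDiffOn (sc n) hU hy) n
  have db : DifferentiableAt ℝ (fun y => divergence (fun z => B z • b z) y i) x :=
    differentiableAt_of_contDiffOn
      (ContDiffOn.sum fun n _ => contDiffOn_pd hU (sb n) n) hU hx
  have dc : DifferentiableAt ℝ (fun y => divergence (fun z => G z • c z) y i) x :=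
    differentiableAt_of_contDiffOn
      (ContDiffOn.sum fun n _ => contDiffOn_pd hU (sc n) n) hU hx
  rw [pd_congr_of_eqOn hU hx e, pd_add db dc,
    pd_divergence_smul hU h.b_smooth h.b_symm hB hx,
    pd_divergence_smul hU h.c_smooth h.c_symm hG hx, curlCoeff]

variable {k : ℕ} {f : E3 → Fin k → ℝ}

theorem contDiffOn_response (hφ : IsIncompressibleDeformation Ω φ) (hΩ : IsOpen Ω)
    (hf : ContDiffOn ℝ ∞ f Ω) {β : (Fin k → ℝ) → ℝ → ℝ → ℝ}
    (hβ : ContDiff ℝ ∞ fun q : (Fin k → ℝ) × ℝ × ℝ => β q.1 q.2.1 q.2.2) :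
    ContDiffOn ℝ ∞ (fun x => β (f (materialPoint Ω φ x)) (I1 Ω φ x) (I2 Ω φ x)) (φ '' Ω) := by
  have h := hφ.strainFields hΩ
  exact hβ.comp_contDiffOn ((hφ.contDiffOn_comp_materialPoint hΩ hf).prodMk
    (h.I_smooth.prodMk h.J_smooth))

theorem smoothExtraStress_of_mem (hφ : IsIncompressibleDeformation Ω φ) (hΩ : IsOpen Ω)
    (hf : ContDiffOn ℝ ∞ f Ω) (hm : m ∈ inhomCauchyMaterials f) : SmoothExtraStress Ω φ m := by
  obtain ⟨β, γ, hβ, hγ, rfl⟩ := hm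
  have h := hφ.strainFields hΩ
  exact fun a n => ((contDiffOn_response hφ hΩ hf hβ).mul (h.b_smooth a n)).add
    ((contDiffOn_response hφ hΩ hf hγ).mul (h.c_smooth a n))

theorem curlFreePressureGradient_iff (hφ : IsIncompressibleDeformation Ω φ) (hΩ : IsOpen Ω)
    {B G : E3 → ℝ} (hB : ContDiffOn ℝ ∞ B (φ '' Ω)) (hG : ContDiffOn ℝ ∞ G (φ '' Ω))
    (hmB : ∀ x, m.β (materialPoint Ω φ x) (I1 Ω φ x) (I2 Ω φ x) = B x)
    (hmG : ∀ x, m.γ (materialPoint Ω φ x) (I1 Ω φ x) (I2 Ω φ x) = G x) :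
    CurlFreePressureGradient Ω φ m ↔
      SymmetricOn (φ '' Ω) (curlCoeff (bField Ω φ) (cField Ω φ) B G) := by
  have e : extraStress Ω φ m = fun z => B z • bField Ω φ z + G z • cField Ω φ z := by
    funext z
    rw [extraStress, hmB, hmG]
  refine forall₂_congr fun x hx => forall₂_congr fun i j => ?_
  rw [e, pd_divergence_add (hφ.strainFields hΩ) hB hG hx,
    pd_divergence_add (hφ.strainFields hΩ) hB hG hx]

end Materials

/-! ### The constraints suffice -/

section Sufficiency

variable {U : Set E3} {T : E3 → Matrix (Fin 3) (Fin 3) ℝ} {I J : E3 → ℝ} {k : ℕ}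
  {F : Fin k → E3 → ℝ}

/-- By the chain rule, the constraints on `T` imply that `g T` has a divergence with symmetric
gradient for every smooth function `g` of the inhomogeneities and the invariants. -/
theorem symmetricOn_of_constraints (hU : IsOpen U)
    (hI : ContDiffOn ℝ ∞ I U) (hJ : ContDiffOn ℝ ∞ J U) (hF : ∀ A, ContDiffOn ℝ ∞ (F A) U)
    (h0 : SymmetricOn U (hessDiv T)) (h1 : SymmetricOn U (inhomCoeff T I))
    (h2 : SymmetricOn U (inhomCoeff T J)) (h11 : SymmetricOn U (mixedCoeff T I I))
    (h22 : SymmetricOn U (mixedCoeff T J J)) (h12 : SymmetricOn U (mixedCoeff T I J))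
    (hA : ∀ A, SymmetricOn U (inhomCoeff T (F A)))
    (hA1 : ∀ A, SymmetricOn U (mixedCoeff T (F A) I))
    (hA2 : ∀ A, SymmetricOn U (mixedCoeff T (F A) J))
    (hAB : ∀ A B, A ≤ B → SymmetricOn U (mixedCoeff T (F A) (F B)))
    {β : (Fin k → ℝ) → ℝ → ℝ → ℝ}
    (hβ : ContDiff ℝ ∞ fun q : (Fin k → ℝ) × ℝ × ℝ => β q.1 q.2.1 q.2.2) :
    SymmetricOn U fun x i j =>
      inhomCoeff T (fun y => β (fun A => F A y) (I y) (J y)) x i j +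
        β (fun A => F A x) (I x) (J x) * hessDiv T x i j := by
  -- All scalar fields are collected in one family, indexed by `Fin k ⊕ Fin 2`.
  let H : (Fin k ⊕ Fin 2 → ℝ) → ℝ := fun q =>
    β (fun A => q (Sum.inl A)) (q (Sum.inr 0)) (q (Sum.inr 1))
  let E : Fin k ⊕ Fin 2 → E3 → ℝ := Sum.elim F ![I, J]
  have hH : ContDiff ℝ ∞ H := hβ.comp (ContDiff.prodMk
    (contDiff_pi.2 fun A => contDiff_apply ℝ ℝ (Sum.inl A))
    ((contDiff_apply ℝ ℝ (Sum.inr 0)).prodMk (contDiff_apply ℝ ℝ (Sum.inr 1))))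
  have hE : ∀ i, ContDiffOn ℝ ∞ (E i) U := by
    rintro (A | i)
    · exact hF A
    · fin_cases i
      exacts [hI, hJ]
  have hinhom : ∀ i, SymmetricOn U (inhomCoeff T (E i)) := by
    rintro (A | i)
    · exact hA A
    · fin_cases i
      exacts [h1, h2]
  have hmixed : ∀ i j, SymmetricOn U (mixedCoeff T (E i) (E j)) := by
    rintro (A | i) (B | j)
    · rcases le_total A B with hle | hle
      · exact hAB A B hle
      · rw [mixedCoeff_comm]
        exact hAB B A hle
    · fin_cases j
      exacts [hA1 A, hA2 A]
    · rw [mixedCoeff_comm]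
      fin_cases i
      exacts [hA1 B, hA2 B]
    · fin_cases i <;> fin_cases j
      exacts [h11, h12, mixedCoeff_comm T I J ▸ h12, h22]
  intro x hx i j
  have e : ∀ i j, inhomCoeff T (fun y => β (fun A => F A y) (I y) (J y)) x i j = _ :=
    inhomCoeff_comp (T := T) hU hH hE hx
  simp only [e, h0 x hx i j, hinhom _ x hx i j, hmixed _ _ x hx i j]

end Sufficiency

section Constraints

variable {Ω : Set E3} {φ : E3 → E3} {m : Material} {k : ℕ} {f : E3 → Fin k → ℝ}

theorem contDiffOn_spatial (hφ : IsIncompressibleDeformation Ω φ) (hΩ : IsOpen Ω)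
    (hf : ContDiffOn ℝ ∞ f Ω) (A : Fin k) :
    ContDiffOn ℝ ∞ (spatial Ω φ fun X => f X A) (φ '' Ω) :=
  hφ.contDiffOn_comp_materialPoint hΩ ((contDiff_apply ℝ ℝ A).comp_contDiffOn hf)

theorem curlFree_of_cauchyConstraints (hφ : IsIncompressibleDeformation Ω φ) (hΩ : IsOpen Ω)
    (hf : ContDiffOn ℝ ∞ f Ω) (h : CauchyConstraints Ω φ) (h' : CauchyInhomConstraints Ω φ f)
    (hm : m ∈ inhomCauchyMaterials f) : CurlFreePressureGradient Ω φ m := by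
  obtain ⟨β, γ, hβ, hγ, rfl⟩ := hm
  have hs := hφ.strainFields hΩ
  have hU := hs.isOpen
  have first : ∀ {T : E3 → Matrix (Fin 3) (Fin 3) ℝ} {g : E3 → ℝ},
      (∀ a n, ContDiffOn ℝ ∞ (fun x => T x a n) (φ '' Ω)) → ContDiffOn ℝ ∞ g (φ '' Ω) →
      SymmetricOn (φ '' Ω) (firstCoeff T g) → SymmetricOn (φ '' Ω) (inhomCoeff T g) := by
    intro T g hT hg hsym x hx i j
    rw [← firstCoeff_eq_inhomCoeff hU hT hg hx, ← firstCoeff_eq_inhomCoeff hU hT hg hx, hsym x hx]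
  have pure : ∀ {T : E3 → Matrix (Fin 3) (Fin 3) ℝ} {g : E3 → ℝ},
      SymmetricOn (φ '' Ω) (pureCoeff T g) → SymmetricOn (φ '' Ω) (mixedCoeff T g g) := by
    intro T g hsym x hx i j
    rw [mixedCoeff_self, mixedCoeff_self, hsym x hx]
  have hF := contDiffOn_spatial hφ hΩ hf
  refine (curlFreePressureGradient_iff hφ hΩ (contDiffOn_response hφ hΩ hf hβ)
    (contDiffOn_response hφ hΩ hf hγ) (fun _ => rfl) (fun _ => rfl)).2 fun x hx i j => ?_
  have hb := symmetricOn_of_constraints hU hs.I_smooth hs.J_smooth hF h.A0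
    (first hs.b_smooth hs.I_smooth h.A1) (first hs.b_smooth hs.J_smooth h.A2) (pure h.A11)
    (pure h.A22) h.A12 h'.C0 h'.C1 h'.C2 h'.C0' hβ x hx i j
  have hc := symmetricOn_of_constraints hU hs.I_smooth hs.J_smooth hF h.B0
    (first hs.c_smooth hs.I_smooth h.B1) (first hs.c_smooth hs.J_smooth h.B2) (pure h.B11)
    (pure h.B22) h.B12 h'.D0 h'.D1 h'.D2 h'.D0' hγ x hx i j
  exact congrArg₂ (· + ·) hb hc

/-! ### Hyperelastic test materials -/

theorem inhomCoeff_center_mul {U : Set E3} {T : E3 → Matrix (Fin 3) (Fin 3) ℝ} {g h : E3 → ℝ}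
    {x : E3} (hU : IsOpen U) (hg : ContDiffOn ℝ ∞ g U) (hh : ContDiffOn ℝ ∞ h U) (hx : x ∈ U)
    (i j : Fin 3) :
    inhomCoeff T (fun y => (g y - g x) * (h y - h x)) x i j = mixedCoeff T g h x i j := by
  rw [inhomCoeff_mul hU (hg.sub contDiffOn_const) (hh.sub contDiffOn_const) hx]
  simp only [mixedCoeff, pd_sub_const, sub_self]
  ring

/-- The energy `W = A(f) P(I₁) Q(I₂)` as a test material: up to the common factor `2`, the
coefficients of `b` and `c` are `B = A P' Q` and `G = -A P Q'`. -/
theorem curlCoeff_symm_of_product (hφ : IsIncompressibleDeformation Ω φ) (hΩ : IsOpen Ω)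
    (hf : ContDiffOn ℝ ∞ f Ω)
    (hcurl : ∀ m ∈ inhomHyperelasticMaterials f, CurlFreePressureGradient Ω φ m)
    {A : (Fin k → ℝ) → ℝ} {P Q P' Q' : ℝ → ℝ} (hA : ContDiff ℝ ∞ A) (hP : ContDiff ℝ ∞ P)
    (hQ : ContDiff ℝ ∞ Q) (hP' : ∀ t, HasDerivAt P (P' t) t) (hQ' : ∀ t, HasDerivAt Q (Q' t) t)
    {B G : E3 → ℝ}
    (hB : ∀ y, A (f (materialPoint Ω φ y)) * P' (I1 Ω φ y) * Q (I2 Ω φ y) = B y)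
    (hG : ∀ y, A (f (materialPoint Ω φ y)) * P (I1 Ω φ y) * Q' (I2 Ω φ y) = -G y) {x : E3}
    (hx : x ∈ φ '' Ω) (i j : Fin 3) :
    curlCoeff (bField Ω φ) (cField Ω φ) B G x i j =
      curlCoeff (bField Ω φ) (cField Ω φ) B G x j i := by
  have hWs : ContDiff ℝ ∞ fun q : (Fin k → ℝ) × ℝ × ℝ => A q.1 * P q.2.1 * Q q.2.2 :=
    ((hA.comp contDiff_fst).mul (hP.comp contDiff_snd.fst)).mul (hQ.comp contDiff_snd.snd)
  obtain ⟨m, hm⟩ : ∃ m : Material, m = ⟨fun X i j => 2 * deriv (fun t => A (f X) * P t * Q j) i,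
    fun X i j => -2 * deriv (fun t => A (f X) * P i * Q t) j⟩ := ⟨_, rfl⟩
  have hmem : m ∈ inhomHyperelasticMaterials f := ⟨fun q s t => A q * P s * Q t, hWs, hm⟩
  have d1 : ∀ q s t, deriv (fun t' => A q * P t' * Q t) s = A q * P' s * Q t := fun q s t =>
    (((hP' s).const_mul (A q)).mul_const (Q t)).deriv
  have d2 : ∀ q s t, deriv (fun t' => A q * P s * Q t') t = A q * P s * Q' t := fun q s t =>
    ((hQ' t).const_mul (A q * P s)).deriv
  have hmB : ∀ y, m.β (materialPoint Ω φ y) (I1 Ω φ y) (I2 Ω φ y) = 2 * B y := fun y => by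
    rw [hm, ← hB]; exact congrArg (2 * ·) (d1 _ _ _)
  have hmG : ∀ y, m.γ (materialPoint Ω φ y) (I1 Ω φ y) (I2 Ω φ y) = 2 * G y := fun y => by
    have : m.γ (materialPoint Ω φ y) (I1 Ω φ y) (I2 Ω φ y) = -2 * -G y := by
      rw [hm, ← hG]; exact congrArg (-2 * ·) (d2 _ _ _)
    rw [this]; ring
  obtain ⟨β, γ, hβ, hγ, hmβ⟩ := inhomHyperelasticMaterials_subset f hmem
  have sB : ContDiffOn ℝ ∞ (fun y => 2 * B y) (φ '' Ω) := by
    simp only [← hmB, hmβ]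
    exact contDiffOn_response hφ hΩ hf hβ
  have sG : ContDiffOn ℝ ∞ (fun y => 2 * G y) (φ '' Ω) := by
    simp only [← hmG, hmβ]
    exact contDiffOn_response hφ hΩ hf hγ
  have := (curlFreePressureGradient_iff hφ hΩ sB sG hmB hmG).1 (hcurl m hmem) x hx i j
  simp only [curlCoeff, inhomCoeff_const_mul] at this ⊢
  linear_combination this / 2

theorem hasDerivAt_center (r t : ℝ) : HasDerivAt (fun t => t - r) 1 t :=
  (hasDerivAt_id t).sub_const r

theorem hasDerivAt_center_sq (r t : ℝ) :
    HasDerivAt (fun t => (t - r) ^ 2 / 2) (t - r) t := by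
  exact (((hasDerivAt_center r t).fun_pow 2).div_const 2).congr_deriv (by simp)

theorem hasDerivAt_center_cube (r t : ℝ) :
    HasDerivAt (fun t => (t - r) ^ 3 / 3) ((t - r) * (t - r)) t := by
  exact (((hasDerivAt_center r t).fun_pow 3).div_const 3).congr_deriv (by norm_num; ring)

theorem contDiff_center (r : ℝ) : ContDiff ℝ ∞ fun t : ℝ => t - r :=
  contDiff_id.sub contDiff_const

theorem contDiff_center_pow (r s : ℝ) (n : ℕ) : ContDiff ℝ ∞ fun t : ℝ => (t - r) ^ n / s :=
  ((contDiff_center r).pow n).div_const s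

/-- The energies `I₁`, `I₂` and the quadratic and cubic monomials in `I₁ - I₁(x)` and
`I₂ - I₂(x)` isolate Ericksen's constraints at the point `x`. -/
theorem ericksenConstraints_of_curlFree (hφ : IsIncompressibleDeformation Ω φ) (hΩ : IsOpen Ω)
    (hcurl : ∀ m ∈ hyperelasticMaterials, CurlFreePressureGradient Ω φ m) :
    EricksenConstraints Ω φ := by
  have hs := hφ.strainFields hΩ
  have hU := hs.isOpen
  have sI := hs.I_smooth
  have sJ := hs.J_smooth
  rw [hyperelasticMaterials_eq fun _ => 0] at hcurl
  have test := fun (P Q P' Q' : ℝ → ℝ) (hP : ContDiff ℝ ∞ P) (hQ : ContDiff ℝ ∞ Q)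
      (hP' : ∀ t, HasDerivAt P (P' t) t) (hQ' : ∀ t, HasDerivAt Q (Q' t) t) (B G : E3 → ℝ)
      hB hG (x : E3) (hx : x ∈ φ '' Ω) i j =>
    curlCoeff_symm_of_product (A := fun _ => 1) hφ hΩ contDiffOn_const hcurl contDiff_const hP hQ
      hP' hQ' (B := B) (G := G) hB hG hx i j
  have c1 : ContDiff ℝ ∞ fun _ : ℝ => (1 : ℝ) := contDiff_const
  have d1 : ∀ t : ℝ, HasDerivAt (fun _ : ℝ => (1 : ℝ)) 0 t := fun t => hasDerivAt_const t 1
  constructor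
  · intro x hx i j
    have := test (fun t => t - 0) (fun _ => 1) (fun _ => 1) (fun _ => 0) (contDiff_center 0) c1
      (hasDerivAt_center 0) d1 (fun _ => 1) (fun _ => 0) (by simp) (by simp) x hx i j
    simp only [curlCoeff, inhomCoeff_const] at this
    simp only [hessDiv'_eq_hessDiv hU hs.b_smooth hs.b_symm hx]
    linear_combination this
  · intro x hx i j
    have := test (fun _ => 1) (fun t => t - 0) (fun _ => 0) (fun _ => 1) c1 (contDiff_center 0)
      d1 (hasDerivAt_center 0) (fun _ => 0) (fun _ => -1) (by simp) (by simp) x hx i j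
    simp only [curlCoeff, inhomCoeff_const] at this
    simp only [hessDiv'_eq_hessDiv hU hs.c_smooth hs.c_symm hx]
    linear_combination -this
  · intro x hx i j
    have := test _ (fun _ => 1) _ (fun _ => 0) (contDiff_center_pow (I1 Ω φ x) 2 2) c1
      (hasDerivAt_center_sq _) d1 (fun y => I1 Ω φ y - I1 Ω φ x) (fun _ => 0) (by simp) (by simp)
      x hx i j
    simp only [curlCoeff, inhomCoeff_const, inhomCoeff_sub_const, sub_self] at this
    simp only [firstCoeff_eq_inhomCoeff hU hs.b_smooth sI hx]
    linear_combination this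
  · intro x hx i j
    have := test (fun _ => 1) _ (fun _ => 0) _ c1 (contDiff_center_pow (I2 Ω φ x) 2 2) d1
      (hasDerivAt_center_sq _) (fun _ => 0) (fun y => -1 * (I2 Ω φ y - I2 Ω φ x)) (by simp)
      (by simp) x hx i j
    simp only [curlCoeff, inhomCoeff_const, inhomCoeff_const_mul, inhomCoeff_sub_const,
      sub_self] at this
    simp only [firstCoeff_eq_inhomCoeff hU hs.c_smooth sJ hx]
    linear_combination -this
  · intro x hx i j
    have := test _ _ _ _ (contDiff_center (I1 Ω φ x)) (contDiff_center (I2 Ω φ x))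
      (hasDerivAt_center _) (hasDerivAt_center _) (fun y => I2 Ω φ y - I2 Ω φ x)
      (fun y => -1 * (I1 Ω φ y - I1 Ω φ x)) (by simp) (by simp) x hx i j
    simp only [curlCoeff, inhomCoeff_const_mul, inhomCoeff_sub_const, sub_self] at this
    simp only [firstCoeff_eq_inhomCoeff hU hs.b_smooth sJ hx,
      firstCoeff_eq_inhomCoeff hU hs.c_smooth sI hx]
    linear_combination this
  · intro x hx i j
    have := test _ (fun _ => 1) _ (fun _ => 0) (contDiff_center_pow (I1 Ω φ x) 3 3) c1
      (hasDerivAt_center_cube _) d1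
      (fun y => (I1 Ω φ y - I1 Ω φ x) * (I1 Ω φ y - I1 Ω φ x)) (fun _ => 0) (by simp) (by simp)
      x hx i j
    simp only [curlCoeff, inhomCoeff_const, inhomCoeff_center_mul hU sI sI hx, mixedCoeff_self,
      sub_self] at this
    linear_combination this / 2
  · intro x hx i j
    have := test (fun _ => 1) _ (fun _ => 0) _ c1 (contDiff_center_pow (I2 Ω φ x) 3 3) d1
      (hasDerivAt_center_cube _) (fun _ => 0)
      (fun y => -1 * ((I2 Ω φ y - I2 Ω φ x) * (I2 Ω φ y - I2 Ω φ x))) (by simp) (by simp) x hx i j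
    simp only [curlCoeff, inhomCoeff_const, inhomCoeff_const_mul,
      inhomCoeff_center_mul hU sJ sJ hx, mixedCoeff_self, sub_self] at this
    linear_combination -this / 2
  · intro x hx i j
    have := test _ _ _ _ (contDiff_center_pow (I1 Ω φ x) 2 2) (contDiff_center (I2 Ω φ x))
      (hasDerivAt_center_sq _) (hasDerivAt_center _)
      (fun y => (I1 Ω φ y - I1 Ω φ x) * (I2 Ω φ y - I2 Ω φ x))
      (fun y => -1 / 2 * ((I1 Ω φ y - I1 Ω φ x) * (I1 Ω φ y - I1 Ω φ x))) (fun y => by ring)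
      (fun y => by ring) x hx i j
    simp only [curlCoeff, inhomCoeff_const_mul, inhomCoeff_center_mul hU sI sJ hx,
      inhomCoeff_center_mul hU sI sI hx, mixedCoeff_self, sub_self] at this
    linear_combination this
  · intro x hx i j
    have := test _ _ _ _ (contDiff_center (I1 Ω φ x)) (contDiff_center_pow (I2 Ω φ x) 2 2)
      (hasDerivAt_center _) (hasDerivAt_center_sq _)
      (fun y => 1 / 2 * ((I2 Ω φ y - I2 Ω φ x) * (I2 Ω φ y - I2 Ω φ x)))
      (fun y => -1 * ((I1 Ω φ y - I1 Ω φ x) * (I2 Ω φ y - I2 Ω φ x))) (fun y => by ring)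
      (fun y => by ring) x hx i j
    simp only [curlCoeff, inhomCoeff_const_mul, inhomCoeff_center_mul hU sI sJ hx,
      inhomCoeff_center_mul hU sJ sJ hx, mixedCoeff_self, sub_self] at this
    linear_combination this

/-- The test energies are those of the homogeneous case with an additional factor
`fᴬ - fᴬ(x)`, and `(fᴬ - fᴬ(x)) (fᴮ - fᴮ(x)) Iᵢ`. -/
theorem hyperelasticInhomConstraints_of_curlFree (hφ : IsIncompressibleDeformation Ω φ)
    (hΩ : IsOpen Ω) (hf : ContDiffOn ℝ ∞ f Ω)
    (hcurl : ∀ m ∈ inhomHyperelasticMaterials f, CurlFreePressureGradient Ω φ m) :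
    HyperelasticInhomConstraints Ω φ f := by
  have hs := hφ.strainFields hΩ
  have hU := hs.isOpen
  have sI := hs.I_smooth
  have sJ := hs.J_smooth
  have sF := contDiffOn_spatial hφ hΩ hf
  have cA : ∀ (A : Fin k) (r : ℝ), ContDiff ℝ ∞ fun q : Fin k → ℝ => q A - r := fun A r =>
    (contDiff_apply ℝ ℝ A).sub contDiff_const
  have c1 : ContDiff ℝ ∞ fun _ : ℝ => (1 : ℝ) := contDiff_const
  have d1 : ∀ t : ℝ, HasDerivAt (fun _ : ℝ => (1 : ℝ)) 0 t := fun t => hasDerivAt_const t 1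
  constructor
  · intro A x hx i j
    set h := spatial Ω φ fun X => f X A with hh
    have sh : ContDiffOn ℝ ∞ h (φ '' Ω) := sF A
    have := curlCoeff_symm_of_product hφ hΩ hf hcurl (cA A (h x)) (contDiff_center 0) c1
      (hasDerivAt_center 0) d1 (B := fun y => h y - h x) (G := fun _ => 0) (by simp [hh, spatial])
      (by simp) hx i j
    simp only [curlCoeff, inhomCoeff_const, inhomCoeff_sub_const, sub_self] at this
    linear_combination this
  · intro A x hx i j
    set h := spatial Ω φ fun X => f X A with hh
    have sh : ContDiffOn ℝ ∞ h (φ '' Ω) := sF A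
    have := curlCoeff_symm_of_product hφ hΩ hf hcurl (cA A (h x)) c1 (contDiff_center 0) d1
      (hasDerivAt_center 0) (B := fun _ => 0) (G := fun y => -1 * (h y - h x)) (by simp)
      (by simp [hh, spatial]) hx i j
    simp only [curlCoeff, inhomCoeff_const, inhomCoeff_const_mul, inhomCoeff_sub_const,
      sub_self] at this
    linear_combination -this
  · intro A x hx i j
    set h := spatial Ω φ fun X => f X A with hh
    have sh : ContDiffOn ℝ ∞ h (φ '' Ω) := sF A
    have := curlCoeff_symm_of_product hφ hΩ hf hcurl (cA A (h x))
      (contDiff_center_pow (I1 Ω φ x) 2 2) c1 (hasDerivAt_center_sq _) d1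
      (B := fun y => (h y - h x) * (I1 Ω φ y - I1 Ω φ x)) (G := fun _ => 0)
      (by simp [hh, spatial]) (by simp) hx i j
    simp only [curlCoeff, inhomCoeff_const, inhomCoeff_center_mul hU sh sI hx, sub_self] at this
    linear_combination this
  · intro A x hx i j
    set h := spatial Ω φ fun X => f X A with hh
    have sh : ContDiffOn ℝ ∞ h (φ '' Ω) := sF A
    have := curlCoeff_symm_of_product hφ hΩ hf hcurl (cA A (h x)) c1
      (contDiff_center_pow (I2 Ω φ x) 2 2) d1 (hasDerivAt_center_sq _)
      (B := fun _ => 0) (G := fun y => -1 * ((h y - h x) * (I2 Ω φ y - I2 Ω φ x)))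
      (by simp) (by simp [hh, spatial]) hx i j
    simp only [curlCoeff, inhomCoeff_const, inhomCoeff_const_mul,
      inhomCoeff_center_mul hU sh sJ hx, sub_self] at this
    linear_combination -this
  · intro A x hx i j
    set h := spatial Ω φ fun X => f X A with hh
    have sh : ContDiffOn ℝ ∞ h (φ '' Ω) := sF A
    have := curlCoeff_symm_of_product hφ hΩ hf hcurl (cA A (h x)) (contDiff_center (I1 Ω φ x))
      (contDiff_center (I2 Ω φ x)) (hasDerivAt_center _) (hasDerivAt_center _)
      (B := fun y => (h y - h x) * (I2 Ω φ y - I2 Ω φ x))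
      (G := fun y => -1 * ((h y - h x) * (I1 Ω φ y - I1 Ω φ x)))
      (by simp [hh, spatial]) (by simp [hh, spatial]) hx i j
    simp only [curlCoeff, inhomCoeff_const_mul, inhomCoeff_center_mul hU sh sI hx,
      inhomCoeff_center_mul hU sh sJ hx, sub_self] at this
    linear_combination this
  · intro A B _ x hx i j
    set h := spatial Ω φ fun X => f X A with hh
    have sh : ContDiffOn ℝ ∞ h (φ '' Ω) := sF A
    set h' := spatial Ω φ fun X => f X B with hh'
    have sh' : ContDiffOn ℝ ∞ h' (φ '' Ω) := sF B
    have := curlCoeff_symm_of_product hφ hΩ hf hcurl ((cA A (h x)).mul (cA B (h' x)))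
      (contDiff_center 0) c1 (hasDerivAt_center 0) d1 (B := fun y => (h y - h x) * (h' y - h' x))
      (G := fun _ => 0) (by simp [hh, hh', spatial]) (by simp) hx i j
    simp only [curlCoeff, inhomCoeff_const, inhomCoeff_center_mul hU sh sh' hx, sub_self] at this
    linear_combination this
  · intro A B _ x hx i j
    set h := spatial Ω φ fun X => f X A with hh
    have sh : ContDiffOn ℝ ∞ h (φ '' Ω) := sF A
    set h' := spatial Ω φ fun X => f X B with hh'
    have sh' : ContDiffOn ℝ ∞ h' (φ '' Ω) := sF B
    have := curlCoeff_symm_of_product hφ hΩ hf hcurl ((cA A (h x)).mul (cA B (h' x)))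
      c1 (contDiff_center 0) d1 (hasDerivAt_center 0) (B := fun _ => 0)
      (G := fun y => -1 * ((h y - h x) * (h' y - h' x))) (by simp) (by simp [hh, hh', spatial])
      hx i j
    simp only [curlCoeff, inhomCoeff_const, inhomCoeff_const_mul,
      inhomCoeff_center_mul hU sh sh' hx, sub_self] at this
    linear_combination -this

end Constraints

/-! ### Equivalence of the Cauchy elastic and the hyperelastic constraints -/

section Equivalence

variable {Ω : Set E3} {φ : E3 → E3} {k : ℕ} {f : E3 → Fin k → ℝ}

theorem EricksenConstraints.cauchyConstraints (hφ : IsIncompressibleDeformation Ω φ)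
    (hΩ : IsOpen Ω) (h : EricksenConstraints Ω φ) : CauchyConstraints Ω φ := by
  have hs := hφ.strainFields hΩ
  have hU := hs.isOpen
  have hcb : ∀ x ∈ φ '' Ω, cField Ω φ x * bField Ω φ x = 1 := fun x hx =>
    mul_eq_one_comm.1 (hs.mul_eq_one x hx)
  have cI := SymmetricOn.pureCoeff_inverse hs.mul_eq_one h.A111
  have bJ := SymmetricOn.pureCoeff_inverse hcb h.A222
  have bIJ : SymmetricOn (φ '' Ω) (mixedCoeff (bField Ω φ) (I1 Ω φ) (I2 Ω φ)) := fun x hx i j => by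
    linear_combination h.A112 x hx i j + cI x hx i j
  have cIJ : SymmetricOn (φ '' Ω) (mixedCoeff (cField Ω φ) (I1 Ω φ) (I2 Ω φ)) := fun x hx i j => by
    linear_combination bJ x hx i j - h.A122 x hx i j
  have fbJ := hs.firstCoeff_symmetricOn h.A111
    (fun x hx => hs.grad_parallel h.A111 bJ bIJ hx) h.A11 h.A12
  have fcI : SymmetricOn (φ '' Ω) (firstCoeff (cField Ω φ) (I1 Ω φ)) := fun x hx i j => by
    linear_combination fbJ x hx i j - h.A12 x hx i j
  refine ⟨fun x hx i j => ?_, h.A11, fbJ, h.A111, bJ, bIJ, fun x hx i j => ?_, fcI, h.A22, cI,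
    h.A222, cIJ⟩
  · simpa only [hessDiv'_eq_hessDiv hU hs.b_smooth hs.b_symm hx] using h.A1 x hx i j
  · simpa only [hessDiv'_eq_hessDiv hU hs.c_smooth hs.c_symm hx] using h.A2 x hx i j

/-- The constraint that couples `b` and `c` decouples pointwise: if `∇I₁ = 0` its second term
vanishes; otherwise `∇I₂` is a multiple of `∇I₁`, and its first term is the same multiple of a
symmetric tensor. -/
theorem HyperelasticInhomConstraints.cauchyInhomConstraints
    (hφ : IsIncompressibleDeformation Ω φ) (hΩ : IsOpen Ω) (hc : CauchyConstraints Ω φ)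
    (h : HyperelasticInhomConstraints Ω φ f) : CauchyInhomConstraints Ω φ f := by
  have hs := hφ.strainFields hΩ
  have hpar : ∀ x ∈ φ '' Ω, ∀ i j, grad (I1 Ω φ) x i * grad (I2 Ω φ) x j =
      grad (I1 Ω φ) x j * grad (I2 Ω φ) x i :=
    fun x hx => hs.grad_parallel hc.A11 hc.A22 hc.A12 hx
  have hD1 : ∀ A, SymmetricOn (φ '' Ω)
      (mixedCoeff (cField Ω φ) (spatial Ω φ fun X => f X A) (I1 Ω φ)) := by
    intro A x hx i j
    by_cases h0 : grad (I1 Ω φ) x = 0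
    · simp [mixedCoeff_eq, h0]
    obtain ⟨n, hn⟩ := Function.ne_iff.1 h0
    obtain ⟨r, hr⟩ : ∃ r : ℝ, grad (I2 Ω φ) x = r • grad (I1 Ω φ) x := by
      refine ⟨grad (I2 Ω φ) x n / grad (I1 Ω φ) x n, funext fun a => ?_⟩
      rw [Pi.smul_apply, smul_eq_mul, div_mul_eq_mul_div, eq_div_iff hn]
      linear_combination hpar x hx n a
    have h1 := h.C11 A x hx i j
    have h2 := h.C12 A x hx i j
    simp only [mixedCoeff_eq, hr, Matrix.smul_vecMul, Pi.smul_apply, smul_eq_mul] at h1 h2 ⊢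
    linear_combination r * h1 - h2
  have hC2 : ∀ A, SymmetricOn (φ '' Ω)
      (mixedCoeff (bField Ω φ) (spatial Ω φ fun X => f X A) (I2 Ω φ)) := fun A x hx i j => by
    linear_combination h.C12 A x hx i j + hD1 A x hx i j
  exact ⟨h.C1, h.C11, hC2, h.C1', h.C2, hD1, h.C22, h.C2'⟩

/-- The cycle: Cauchy elastic constraints, `dξ = 0` for Cauchy elasticity, `dξ = 0` for
hyperelasticity, hyperelastic constraints, Cauchy elastic constraints. -/
theorem inhomogeneity_characterizations (hφ : IsIncompressibleDeformation Ω φ) (hΩ : IsOpen Ω)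
    (hc : CauchyConstraints Ω φ) (hf : ContDiffOn ℝ ∞ f Ω) :
    (CauchyInhomConstraints Ω φ f ↔ HyperelasticInhomConstraints Ω φ f) ∧
    ((∀ m ∈ inhomCauchyMaterials f, CurlFreePressureGradient Ω φ m) ↔
      CauchyInhomConstraints Ω φ f) ∧
    ((∀ m ∈ inhomHyperelasticMaterials f, CurlFreePressureGradient Ω φ m) ↔
      HyperelasticInhomConstraints Ω φ f) := by
  have h1 : HyperelasticInhomConstraints Ω φ f → CauchyInhomConstraints Ω φ f :=
    HyperelasticInhomConstraints.cauchyInhomConstraints hφ hΩ hc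
  have h2 : CauchyInhomConstraints Ω φ f →
      ∀ m ∈ inhomCauchyMaterials f, CurlFreePressureGradient Ω φ m := fun h m hm =>
    curlFree_of_cauchyConstraints hφ hΩ hf hc h hm
  have h3 : (∀ m ∈ inhomCauchyMaterials f, CurlFreePressureGradient Ω φ m) →
      ∀ m ∈ inhomHyperelasticMaterials f, CurlFreePressureGradient Ω φ m := fun h m hm =>
    h m (inhomHyperelasticMaterials_subset f hm)
  have h4 := hyperelasticInhomConstraints_of_curlFree hφ hΩ hf
  exact ⟨⟨fun h => h4 (h3 (h2 h)), h1⟩, ⟨fun h => h1 (h4 (h3 h)), h2⟩,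
    ⟨h4, fun h => h3 (h2 (h1 h))⟩⟩

theorem deformation_characterizations (hφ : IsIncompressibleDeformation Ω φ) (hΩ : IsOpen Ω) :
    (CauchyConstraints Ω φ ↔ EricksenConstraints Ω φ) ∧
    ((∀ m ∈ cauchyMaterials, CurlFreePressureGradient Ω φ m) ↔ CauchyConstraints Ω φ) ∧
    ((∀ m ∈ hyperelasticMaterials, CurlFreePressureGradient Ω φ m) ↔
      EricksenConstraints Ω φ) := by
  have h1 : EricksenConstraints Ω φ → CauchyConstraints Ω φ :=
    EricksenConstraints.cauchyConstraints hφ hΩ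
  have h2 : CauchyConstraints Ω φ → ∀ m ∈ cauchyMaterials, CurlFreePressureGradient Ω φ m := by
    intro h m hm
    rw [cauchyMaterials_eq fun _ => 0] at hm
    exact curlFree_of_cauchyConstraints hφ hΩ contDiffOn_const h
      ⟨fun A => A.elim0, fun A => A.elim0, fun A => A.elim0, fun A => A.elim0, fun A => A.elim0,
        fun A => A.elim0, fun A => A.elim0, fun A => A.elim0⟩ hm
  have h3 : (∀ m ∈ cauchyMaterials, CurlFreePressureGradient Ω φ m) →
      ∀ m ∈ hyperelasticMaterials, CurlFreePressureGradient Ω φ m := fun h m hm =>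
    h m (hyperelasticMaterials_subset hm)
  have h4 := ericksenConstraints_of_curlFree hφ hΩ
  exact ⟨⟨fun h => h4 (h3 (h2 h)), h1⟩, ⟨fun h => h1 (h4 (h3 h)), h2⟩,
    ⟨h4, fun h => h3 (h2 (h1 h))⟩⟩

theorem smoothExtraStress_of_mem_cauchyMaterials (hφ : IsIncompressibleDeformation Ω φ)
    (hΩ : IsOpen Ω) {m : Material} (hm : m ∈ cauchyMaterials) : SmoothExtraStress Ω φ m := by
  rw [cauchyMaterials_eq fun _ => 0] at hm
  exact smoothExtraStress_of_mem hφ hΩ contDiffOn_const hm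

theorem forall_admitsLocalEquilibrium_iff {M : Set Material} (hU : IsOpen (φ '' Ω))
    (hM : ∀ m ∈ M, SmoothExtraStress Ω φ m) :
    (∀ m ∈ M, AdmitsLocalEquilibrium Ω φ m) ↔ ∀ m ∈ M, CurlFreePressureGradient Ω φ m :=
  forall₂_congr fun m hm => admitsLocalEquilibrium_iff hU (hM m hm)

theorem forall_admitsEquilibrium_iff {M : Set Material} (hU : IsOpen (φ '' Ω))
    (hsc : IsSimplyConnected (φ '' Ω)) (hM : ∀ m ∈ M, SmoothExtraStress Ω φ m) :
    (∀ m ∈ M, AdmitsEquilibrium Ω φ m) ↔ ∀ m ∈ M, CurlFreePressureGradient Ω φ m :=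
  forall₂_congr fun m hm => admitsEquilibrium_iff hU hsc (hM m hm)

theorem AdmitsEquilibrium.admitsLocalEquilibrium {m : Material} (hU : IsOpen (φ '' Ω))
    (h : AdmitsEquilibrium Ω φ m) : AdmitsLocalEquilibrium Ω φ m := by
  obtain ⟨p, hp⟩ := h
  exact fun x hx => ⟨φ '' Ω, hU, hx, subset_rfl, p, hp⟩

end Equivalence

end IncompressibleElasticity

theorem proposition3 (Ω : Set E3) (hΩ : IsOpen Ω) :
    -- the universality constraints
    (∀ φ : E3 → E3, IsIncompressibleDeformation Ω φ →
      (CauchyConstraints Ω φ ↔ EricksenConstraints Ω φ) ∧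
      ((∀ m ∈ cauchyMaterials, CurlFreePressureGradient Ω φ m) ↔ CauchyConstraints Ω φ) ∧
      ((∀ m ∈ hyperelasticMaterials, CurlFreePressureGradient Ω φ m) ↔
        EricksenConstraints Ω φ) ∧
      (φ ∈ locallyUniversalDeformations cauchyMaterials Ω ↔ CauchyConstraints Ω φ) ∧
      (φ ∈ locallyUniversalDeformations hyperelasticMaterials Ω ↔ EricksenConstraints Ω φ)) ∧
    -- the universal deformations
    locallyUniversalDeformations cauchyMaterials Ω =
      locallyUniversalDeformations hyperelasticMaterials Ω ∧
    (IsSimplyConnected Ω →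
      universalDeformations cauchyMaterials Ω = universalDeformations hyperelasticMaterials Ω) ∧
    -- the universal inhomogeneity constraints
    (∀ φ ∈ locallyUniversalDeformations cauchyMaterials Ω,
      ∀ (k : ℕ) (f : E3 → Fin k → ℝ), ContDiffOn ℝ ∞ f Ω →
        (CauchyInhomConstraints Ω φ f ↔ HyperelasticInhomConstraints Ω φ f) ∧
        ((∀ m ∈ inhomCauchyMaterials f, CurlFreePressureGradient Ω φ m) ↔
          CauchyInhomConstraints Ω φ f) ∧
        ((∀ m ∈ inhomHyperelasticMaterials f, CurlFreePressureGradient Ω φ m) ↔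
          HyperelasticInhomConstraints Ω φ f) ∧
        (f ∈ locallyUniversalInhomogeneities inhomCauchyMaterials Ω φ ↔
          CauchyInhomConstraints Ω φ f) ∧
        (f ∈ locallyUniversalInhomogeneities inhomHyperelasticMaterials Ω φ ↔
          HyperelasticInhomConstraints Ω φ f)) ∧
    -- the universal inhomogeneities
    (∀ φ ∈ locallyUniversalDeformations cauchyMaterials Ω, ∀ k : ℕ,
      locallyUniversalInhomogeneities (k := k) inhomCauchyMaterials Ω φ =
        locallyUniversalInhomogeneities (k := k) inhomHyperelasticMaterials Ω φ) ∧
    (IsSimplyConnected Ω → ∀ φ ∈ universalDeformations cauchyMaterials Ω, ∀ k : ℕ,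
      universalInhomogeneities (k := k) inhomCauchyMaterials Ω φ =
        universalInhomogeneities (k := k) inhomHyperelasticMaterials Ω φ) := by
  have smoothC : ∀ {φ : E3 → E3}, IsIncompressibleDeformation Ω φ → ∀ m ∈ cauchyMaterials,
      SmoothExtraStress Ω φ m := fun hφ m hm => smoothExtraStress_of_mem_cauchyMaterials hφ hΩ hm
  have smoothH : ∀ {φ : E3 → E3}, IsIncompressibleDeformation Ω φ → ∀ m ∈ hyperelasticMaterials,
      SmoothExtraStress Ω φ m := fun hφ m hm => smoothC hφ m (hyperelasticMaterials_subset hm)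
  have smoothIC : ∀ {φ : E3 → E3}, IsIncompressibleDeformation Ω φ → ∀ {k : ℕ}
      {f : E3 → Fin k → ℝ}, ContDiffOn ℝ ∞ f Ω → ∀ m ∈ inhomCauchyMaterials f,
      SmoothExtraStress Ω φ m := fun hφ _ _ hf m hm => smoothExtraStress_of_mem hφ hΩ hf hm
  have smoothIH : ∀ {φ : E3 → E3}, IsIncompressibleDeformation Ω φ → ∀ {k : ℕ}
      {f : E3 → Fin k → ℝ}, ContDiffOn ℝ ∞ f Ω → ∀ m ∈ inhomHyperelasticMaterials f,
      SmoothExtraStress Ω φ m := fun hφ _ f hf m hm =>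
    smoothIC hφ hf m (inhomHyperelasticMaterials_subset f hm)
  have locC : ∀ {φ : E3 → E3}, IsIncompressibleDeformation Ω φ →
      (φ ∈ locallyUniversalDeformations cauchyMaterials Ω ↔ CauchyConstraints Ω φ) := by
    intro φ hφ
    rw [← (deformation_characterizations hφ hΩ).2.1,
      ← forall_admitsLocalEquilibrium_iff (hφ.isOpen_image hΩ) (smoothC hφ)]
    exact and_iff_right hφ
  have locH : ∀ {φ : E3 → E3}, IsIncompressibleDeformation Ω φ →
      (φ ∈ locallyUniversalDeformations hyperelasticMaterials Ω ↔ EricksenConstraints Ω φ) := by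
    intro φ hφ
    rw [← (deformation_characterizations hφ hΩ).2.2,
      ← forall_admitsLocalEquilibrium_iff (hφ.isOpen_image hΩ) (smoothH hφ)]
    exact and_iff_right hφ
  have locIC : ∀ {φ : E3 → E3}, φ ∈ locallyUniversalDeformations cauchyMaterials Ω → ∀ {k : ℕ}
      {f : E3 → Fin k → ℝ}, ContDiffOn ℝ ∞ f Ω →
      (f ∈ locallyUniversalInhomogeneities inhomCauchyMaterials Ω φ ↔
        CauchyInhomConstraints Ω φ f) := by
    intro φ hφ k f hf
    rw [← (inhomogeneity_characterizations hφ.1 hΩ ((locC hφ.1).1 hφ) hf).2.1,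
      ← forall_admitsLocalEquilibrium_iff (hφ.1.isOpen_image hΩ) (smoothIC hφ.1 hf)]
    exact and_iff_right hf
  have locIH : ∀ {φ : E3 → E3}, φ ∈ locallyUniversalDeformations cauchyMaterials Ω → ∀ {k : ℕ}
      {f : E3 → Fin k → ℝ}, ContDiffOn ℝ ∞ f Ω →
      (f ∈ locallyUniversalInhomogeneities inhomHyperelasticMaterials Ω φ ↔
        HyperelasticInhomConstraints Ω φ f) := by
    intro φ hφ k f hf
    rw [← (inhomogeneity_characterizations hφ.1 hΩ ((locC hφ.1).1 hφ) hf).2.2,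
      ← forall_admitsLocalEquilibrium_iff (hφ.1.isOpen_image hΩ) (smoothIH hφ.1 hf)]
    exact and_iff_right hf
  refine ⟨fun φ hφ => ?_, ?_, fun hsc => ?_, fun φ hφ k f hf => ?_, fun φ hφ k => ?_,
    fun hsc φ hφ k => ?_⟩
  · obtain ⟨h1, h2, h3⟩ := deformation_characterizations hφ hΩ
    exact ⟨h1, h2, h3, locC hφ, locH hφ⟩
  · ext φ
    by_cases hφ : IsIncompressibleDeformation Ω φ
    · rw [locC hφ, locH hφ, (deformation_characterizations hφ hΩ).1]
    · exact iff_of_false (fun h => hφ h.1) fun h => hφ h.1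
  · ext φ
    refine and_congr_right fun hφ => ?_
    have hU := hφ.isOpen_image hΩ
    have hscU := hφ.isSimplyConnected_image hΩ hsc
    obtain ⟨h1, h2, h3⟩ := deformation_characterizations hφ hΩ
    rw [forall_admitsEquilibrium_iff hU hscU (smoothC hφ),
      forall_admitsEquilibrium_iff hU hscU (smoothH hφ), h2, h3, h1]
  · obtain ⟨h1, h2, h3⟩ := inhomogeneity_characterizations hφ.1 hΩ ((locC hφ.1).1 hφ) hf
    exact ⟨h1, h2, h3, locIC hφ hf, locIH hφ hf⟩
  · ext f
    by_cases hf : ContDiffOn ℝ ∞ f Ω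
    · rw [locIC hφ hf, locIH hφ hf,
        (inhomogeneity_characterizations hφ.1 hΩ ((locC hφ.1).1 hφ) hf).1]
    · exact iff_of_false (fun h => hf h.1) fun h => hf h.1
  · ext f
    refine and_congr_right fun hf => ?_
    have hU := hφ.1.isOpen_image hΩ
    have hscU := hφ.1.isSimplyConnected_image hΩ hsc
    have hloc : φ ∈ locallyUniversalDeformations cauchyMaterials Ω :=
      ⟨hφ.1, fun m hm => (hφ.2 m hm).admitsLocalEquilibrium hU⟩
    obtain ⟨h1, h2, h3⟩ := inhomogeneity_characterizations hφ.1 hΩ ((locC hφ.1).1 hloc) hf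
    rw [forall_admitsEquilibrium_iff hU hscU (smoothIC hφ.1 hf),
      forall_admitsEquilibrium_iff hU hscU (smoothIH hφ.1 hf), h2, h3, h1]
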